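/- Let $k$ be a field and let $\Lambda=\bigoplus_{i\ge 0}\Lambda_i$ be a graded $k$-algebra (neither noetherianity nor any finiteness of $\Lambda$ is assumed). Let $\operatorname{Gr}\Lambda$ be the abelian category of $\mathbb Z$-graded $\Lambda$-modules $M=\bigoplus_{i\in\mathbb Z}M_i$ with homomorphisms of degree $0$, and write $M\langle j\rangle$ for the graded shift, $(M\langle j\rangle)_i=M_{i-j}$. Let $T$ be a graded self-orthogonal $\Lambda$-module, that is, a finitely generated graded $\Lambda$-module concentrated in degree $0$ which is basic (a finite direct sum of pairwise non-isomorphic indecomposable graded modules) and satisfies $\operatorname{Ext}^i_{\operatorname{Gr}\Lambda}(T,T\langle j\rangle)=0$ for all integers $i\ge 0$ and $j$ with $i\ne j$. Then there is an isomorphism of graded $k$-algebras $$\Bigl[\bigoplus_{i\ge 0}\operatorname{Ext}^i_{\Lambda}(T,T)\Bigr]^{\mathrm{op}}\;\cong\;\Bigl[\bigoplus_{i\ge 0}\operatorname{Ext}^i_{\operatorname{Gr}\Lambda}(T,T\langle i\rangle)\Bigr]^{\mathrm{op}}.$$ Here $\operatorname{Ext}_\Lambda$ is taken in the category of ungraded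 $\Lambda$-modules, the left-hand algebra carries the Yoneda product $xy=x\circ y$, and in the right-hand algebra the product of $x\in\operatorname{Ext}^i_{\operatorname{Gr}\Lambda}(T,T\langle i\rangle)$ and $y\in\operatorname{Ext}^j_{\operatorname{Gr}\Lambda}(T,T\langle j\rangle)$ is the Yoneda product $x\langle j\rangle\circ y\in\operatorname{Ext}^{i+j}_{\operatorname{Gr}\Lambda}(T,T\langle i+j\rangle)$. -/

import Mathlib

open CategoryTheory
open scoped DirectSum

universe v u

/-- A family of subgroups together with projections onto them that kill the other members
of the family, and which spans the whole group, is an internal direct sum decomposition. -/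
theorem isInternal_of_proj {M : Type*} [AddCommGroup M] {D : ℤ → AddSubgroup M}
    (p : ℤ → M →+ M) (h_same : ∀ i, ∀ m ∈ D i, p i m = m)
    (h_ne : ∀ i j, j ≠ i → ∀ m ∈ D j, p i m = 0)
    (h_top : ∀ m : M, m ∈ ⨆ i, D i) : DirectSum.IsInternal D := by
  have key : ∀ (i : ℤ) (x : ⨁ j, D j), p i (DirectSum.coeAddMonoidHom D x) = x i := by
    intro i x
    induction x using DirectSum.induction_on with
    | zero => simp
    | of j y =>
      rw [DirectSum.coeAddMonoidHom_of]
      by_cases h : j = i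
      · subst h
        rw [h_same j _ y.2, DirectSum.of_eq_same]
      · rw [h_ne i j h _ y.2, DirectSum.of_eq_of_ne _ _ _ (Ne.symm h)]
        rfl
    | add x y hx hy => rw [map_add, map_add, hx, hy]; rfl
  refine ⟨?_, ?_⟩
  · intro x y hxy
    refine DFinsupp.ext fun i => Subtype.ext ?_
    rw [← key, ← key]
    exact congrArg (p i) hxy
  · intro m
    have h : (⨆ i, D i) ≤ (DirectSum.coeAddMonoidHom D).range := by
      refine iSup_le fun i x hx => ⟨DirectSum.of (fun j => D j) i ⟨x, hx⟩, ?_⟩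
      rw [DirectSum.coeAddMonoidHom_of]
    exact h (h_top m)

/-- A graded (left) module `M = ⨁_{i ∈ ℤ} M_i` over the graded `k`-algebra `Λ = ⨁_{i ≥ 0} Λ_i`.
The pieces `M_i` are automatically `k`-subspaces, since `k` maps into `Λ_0`. -/
structure GrMod {k : Type v} [Field k] {Λ : Type u} [Ring Λ] [Algebra k Λ]
    (𝒜 : ℕ → Submodule k Λ) [GradedAlgebra 𝒜] : Type (u + 1) where
  carrier : Type u
  [addCommGroup : AddCommGroup carrier]
  [module : Module Λ carrier]
  /-- the homogeneous piece in the given degree -/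
  deg : ℤ → AddSubgroup carrier
  isInternal : DirectSum.IsInternal deg
  smul_mem : ∀ {i : ℕ} {j : ℤ} {a : Λ} {m : carrier},
    a ∈ 𝒜 i → m ∈ deg j → a • m ∈ deg (i + j)

namespace GrMod

attribute [instance] GrMod.addCommGroup GrMod.module

section

variable {k : Type v} [Field k] {Λ : Type u} [Ring Λ] [Algebra k Λ]
  {𝒜 : ℕ → Submodule k Λ} [GradedAlgebra 𝒜]

/-- The projection of a graded module onto its homogeneous piece of degree `i`. -/
noncomputable def proj (M : GrMod 𝒜) (i : ℤ) : M.carrier →+ M.carrier :=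
  letI := M.isInternal.chooseDecomposition
  { toFun := fun m => (DirectSum.decompose M.deg m i : M.carrier)
    map_zero' := by simp
    map_add' := by simp }

theorem proj_mem (M : GrMod 𝒜) (i : ℤ) (m : M.carrier) : M.proj i m ∈ M.deg i := by
  let := M.isInternal.chooseDecomposition
  exact (DirectSum.decompose M.deg m i).2

theorem proj_same (M : GrMod 𝒜) {i : ℤ} {m : M.carrier} (hm : m ∈ M.deg i) :
    M.proj i m = m := by
  let := M.isInternal.chooseDecomposition
  exact DirectSum.decompose_of_mem_same M.deg hm

theorem proj_ne (M : GrMod 𝒜) {i j : ℤ} {m : M.carrier} (hm : m ∈ M.deg j) (h : j ≠ i) :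
    M.proj i m = 0 := by
  let := M.isInternal.chooseDecomposition
  exact DirectSum.decompose_of_mem_ne M.deg hm h

theorem exists_eq_sum_proj (M : GrMod 𝒜) (m : M.carrier) :
    ∃ s : Finset ℤ, m = ∑ i ∈ s, M.proj i m := by
  classical
  let := M.isInternal.chooseDecomposition
  exact ⟨_, (DirectSum.sum_support_decompose M.deg m).symm⟩

theorem mem_iSup_deg (M : GrMod 𝒜) (m : M.carrier) : m ∈ ⨆ i, M.deg i := by
  obtain ⟨s, hs⟩ := M.exists_eq_sum_proj m
  rw [hs]
  exact sum_mem fun i _ => AddSubgroup.mem_iSup_of_mem i (M.proj_mem i m)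

/-- Morphisms of graded modules: `Λ`-linear maps preserving the degree. -/
@[ext]
structure Hom (M N : GrMod 𝒜) : Type u where
  toLin : M.carrier →ₗ[Λ] N.carrier
  map_mem : ∀ {i : ℤ} {m : M.carrier}, m ∈ M.deg i → toLin m ∈ N.deg i

/-- The category `Gr Λ` of graded modules and homomorphisms of degree `0`. -/
instance : Category (GrMod 𝒜) where
  Hom M N := Hom M N
  id M := ⟨LinearMap.id, fun h => h⟩
  comp f g := ⟨g.toLin ∘ₗ f.toLin, fun h => g.map_mem (f.map_mem h)⟩

/-- The underlying linear map of a morphism in `Gr Λ`. -/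
def Hom.lin {M N : GrMod 𝒜} (f : M ⟶ N) : M.carrier →ₗ[Λ] N.carrier := Hom.toLin f

/-- The morphism in `Gr Λ` given by a linear map preserving the degree. -/
def ofLin {M N : GrMod 𝒜} (f : M.carrier →ₗ[Λ] N.carrier)
    (hf : ∀ {i : ℤ} {m : M.carrier}, m ∈ M.deg i → f m ∈ N.deg i) : M ⟶ N :=
  (⟨f, hf⟩ : Hom M N)

theorem lin_mem {M N : GrMod 𝒜} (f : M ⟶ N) {i : ℤ} {m : M.carrier} (hm : m ∈ M.deg i) :
    Hom.lin f m ∈ N.deg i := Hom.map_mem f hm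

@[simp] theorem lin_ofLin {M N : GrMod 𝒜} (f : M.carrier →ₗ[Λ] N.carrier)
    (hf : ∀ {i : ℤ} {m : M.carrier}, m ∈ M.deg i → f m ∈ N.deg i) :
    Hom.lin (ofLin f hf) = f := rfl

@[simp] theorem lin_id (M : GrMod 𝒜) : Hom.lin (𝟙 M) = LinearMap.id := rfl

@[simp] theorem lin_comp {M N P : GrMod 𝒜} (f : M ⟶ N) (g : N ⟶ P) :
    Hom.lin (f ≫ g) = Hom.lin g ∘ₗ Hom.lin f := rfl

theorem hom_ext {M N : GrMod 𝒜} {f g : M ⟶ N} (h : ∀ m, Hom.lin f m = Hom.lin g m) : f = g :=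
  Hom.ext (LinearMap.ext h)

theorem congr_lin {M N : GrMod 𝒜} {f g : M ⟶ N} (h : f = g) (m : M.carrier) :
    Hom.lin f m = Hom.lin g m := by rw [h]

theorem lin_proj {M N : GrMod 𝒜} (f : M ⟶ N) (i : ℤ) (m : M.carrier) :
    Hom.lin f (M.proj i m) = N.proj i (Hom.lin f m) := by
  obtain ⟨s, hs⟩ := M.exists_eq_sum_proj m
  have key : ∀ j, Hom.lin f (M.proj i (M.proj j m)) = N.proj i (Hom.lin f (M.proj j m)) := by
    intro j
    by_cases h : j = i
    · subst h
      rw [M.proj_same (M.proj_mem _ _), N.proj_same (lin_mem f (M.proj_mem _ _))]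
    · rw [M.proj_ne (M.proj_mem _ _) h, N.proj_ne (lin_mem f (M.proj_mem _ _)) h, map_zero]
  rw [hs]
  simp only [map_sum, key]

theorem mem_of_lin_mem {M N : GrMod 𝒜} (f : M ⟶ N) (hf : Function.Injective (Hom.lin f))
    {i : ℤ} {m : M.carrier} (hm : Hom.lin f m ∈ N.deg i) : m ∈ M.deg i := by
  have : M.proj i m = m := hf (by rw [lin_proj, N.proj_same hm])
  rw [← this]
  exact M.proj_mem i m

theorem exists_mem_of_surjective {M N : GrMod 𝒜} (f : M ⟶ N)
    (hf : Function.Surjective (Hom.lin f)) {i : ℤ} {n : N.carrier} (hn : n ∈ N.deg i) :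
    ∃ m ∈ M.deg i, Hom.lin f m = n := by
  obtain ⟨m, rfl⟩ := hf n
  exact ⟨M.proj i m, M.proj_mem i m, by rw [lin_proj, N.proj_same hn]⟩

theorem algebraMap_mem_zero (c : k) : algebraMap k Λ c ∈ 𝒜 0 := by
  rw [Algebra.algebraMap_eq_smul_one]
  exact Submodule.smul_mem _ _ (SetLike.GradedOne.one_mem)

theorem algebraMap_smul_mem (M : GrMod 𝒜) (c : k) {i : ℤ} {m : M.carrier} (hm : m ∈ M.deg i) :
    algebraMap k Λ c • m ∈ M.deg i := by
  have := M.smul_mem (algebraMap_mem_zero (𝒜 := 𝒜) c) hm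
  rwa [Nat.cast_zero, zero_add] at this

instance (M N : GrMod 𝒜) : Zero (M ⟶ N) := ⟨ofLin 0 fun _ => zero_mem _⟩

instance (M N : GrMod 𝒜) : Add (M ⟶ N) :=
  ⟨fun f g => ofLin (Hom.lin f + Hom.lin g) fun h => add_mem (lin_mem f h) (lin_mem g h)⟩

instance (M N : GrMod 𝒜) : Neg (M ⟶ N) :=
  ⟨fun f => ofLin (-Hom.lin f) fun h => neg_mem (lin_mem f h)⟩

instance (M N : GrMod 𝒜) : Sub (M ⟶ N) :=
  ⟨fun f g => ofLin (Hom.lin f - Hom.lin g) fun h => sub_mem (lin_mem f h) (lin_mem g h)⟩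

instance (M N : GrMod 𝒜) : SMul ℕ (M ⟶ N) :=
  ⟨fun n f => ofLin (n • Hom.lin f) fun h => nsmul_mem (lin_mem f h) n⟩

instance (M N : GrMod 𝒜) : SMul ℤ (M ⟶ N) :=
  ⟨fun n f => ofLin (n • Hom.lin f) fun h => zsmul_mem (lin_mem f h) n⟩

theorem lin_injective (M N : GrMod 𝒜) :
    Function.Injective (Hom.lin : (M ⟶ N) → (M.carrier →ₗ[Λ] N.carrier)) :=
  fun _ _ h => Hom.ext h

instance (M N : GrMod 𝒜) : AddCommGroup (M ⟶ N) :=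
  (lin_injective M N).addCommGroup _ rfl (fun _ _ => rfl) (fun _ => rfl) (fun _ _ => rfl)
    (fun _ _ => rfl) (fun _ _ => rfl)

@[simp] theorem lin_zero (M N : GrMod 𝒜) : Hom.lin (0 : M ⟶ N) = 0 := rfl

@[simp] theorem lin_add {M N : GrMod 𝒜} (f g : M ⟶ N) :
    Hom.lin (f + g) = Hom.lin f + Hom.lin g := rfl

@[simp] theorem lin_sub {M N : GrMod 𝒜} (f g : M ⟶ N) :
    Hom.lin (f - g) = Hom.lin f - Hom.lin g := rfl

instance : Preadditive (GrMod 𝒜) where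
  add_comp _ _ _ f f' g := hom_ext fun m => by simp
  comp_add _ _ _ f g g' := hom_ext fun m => by simp

/-- The scalar `c : k` acts on a morphism through the central element `algebraMap k Λ c`. -/
instance (M N : GrMod 𝒜) : SMul k (M ⟶ N) :=
  ⟨fun c f => ofLin
    { toFun := fun m => algebraMap k Λ c • Hom.lin f m
      map_add' := fun x y => by rw [map_add, smul_add]
      map_smul' := fun a x => by
        rw [map_smul, RingHom.id_apply, smul_smul, smul_smul, Algebra.commutes] }
    fun h => algebraMap_smul_mem N c (lin_mem f h)⟩

theorem lin_smul_apply {M N : GrMod 𝒜} (c : k) (f : M ⟶ N) (m : M.carrier) :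
    Hom.lin (c • f) m = algebraMap k Λ c • Hom.lin f m := rfl

instance (M N : GrMod 𝒜) : Module k (M ⟶ N) where
  one_smul f := hom_ext fun m => by rw [lin_smul_apply, map_one, one_smul]
  mul_smul a b f := hom_ext fun m => by
    rw [lin_smul_apply, lin_smul_apply, lin_smul_apply, map_mul, mul_smul]
  smul_zero a := hom_ext fun m => by rw [lin_smul_apply, lin_zero, LinearMap.zero_apply, smul_zero]
  smul_add a f g := hom_ext fun m => by
    simp only [lin_smul_apply, lin_add, LinearMap.add_apply, smul_add]
  add_smul a b f := hom_ext fun m => by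
    simp only [lin_smul_apply, lin_add, LinearMap.add_apply, map_add, add_smul]
  zero_smul f := hom_ext fun m => by
    rw [lin_smul_apply, map_zero, zero_smul, lin_zero, LinearMap.zero_apply]

instance : Linear k (GrMod 𝒜) where
  smul_comp _ _ _ c f g := hom_ext fun m => by
    simp only [lin_comp, LinearMap.comp_apply, lin_smul_apply, map_smul]
  comp_smul _ _ _ f c g := hom_ext fun m => by
    simp only [lin_comp, LinearMap.comp_apply, lin_smul_apply]

/-! ### `Gr Λ` is abelian -/

/-- The kernel of a morphism of graded modules. -/
noncomputable def ker {M N : GrMod 𝒜} (f : M ⟶ N) : GrMod 𝒜 where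
  carrier := LinearMap.ker (Hom.lin f)
  deg i := (M.deg i).comap (LinearMap.ker (Hom.lin f)).subtype.toAddMonoidHom
  isInternal := by
    have hp : ∀ i (m : LinearMap.ker (Hom.lin f)), M.proj i m ∈ LinearMap.ker (Hom.lin f) := by
      intro i m
      rw [LinearMap.mem_ker, lin_proj, LinearMap.mem_ker.1 m.2, map_zero]
    refine isInternal_of_proj
      (fun i => AddMonoidHom.mk' (fun m => ⟨M.proj i m, hp i m⟩) fun a b => Subtype.ext ?_)
      (fun i m hm => Subtype.ext (M.proj_same hm))
      (fun i j h m hm => Subtype.ext (M.proj_ne hm h)) fun m => ?_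
    · simp
    · obtain ⟨s, hs⟩ := M.exists_eq_sum_proj (m : M.carrier)
      have : m = ∑ i ∈ s, (⟨M.proj i m, hp i m⟩ : LinearMap.ker (Hom.lin f)) := by
        apply Subtype.ext
        rw [AddSubmonoidClass.coe_finsetSum]
        exact hs
      rw [this]
      exact sum_mem fun i _ => AddSubgroup.mem_iSup_of_mem i (M.proj_mem i (m : M.carrier))
  smul_mem ha hm := M.smul_mem ha hm

/-- The inclusion of the kernel. -/
noncomputable def kerι {M N : GrMod 𝒜} (f : M ⟶ N) : ker f ⟶ M :=
  ofLin (LinearMap.ker (Hom.lin f)).subtype fun h => h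

theorem kerι_comp {M N : GrMod 𝒜} (f : M ⟶ N) : kerι f ≫ f = 0 :=
  hom_ext fun m => LinearMap.mem_ker.1 m.2

/-- The cokernel of a morphism of graded modules. -/
noncomputable def coker {M N : GrMod 𝒜} (f : M ⟶ N) : GrMod 𝒜 where
  carrier := N.carrier ⧸ LinearMap.range (Hom.lin f)
  deg i := (N.deg i).map (LinearMap.range (Hom.lin f)).mkQ.toAddMonoidHom
  isInternal := by
    let q := (LinearMap.range (Hom.lin f)).mkQ.toAddMonoidHom
    have hp : ∀ i, (LinearMap.range (Hom.lin f)).toAddSubgroup ≤ (q.comp (N.proj i)).ker := by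
      rintro i _ ⟨m, rfl⟩
      refine (Submodule.Quotient.mk_eq_zero _).2 ?_
      rw [← lin_proj]
      exact ⟨_, rfl⟩
    refine isInternal_of_proj
      (fun i => QuotientAddGroup.lift (LinearMap.range (Hom.lin f)).toAddSubgroup
        (q.comp (N.proj i)) (hp i)) ?_ ?_ ?_
    · rintro i _ ⟨n, hn, rfl⟩
      exact congrArg q (N.proj_same hn)
    · rintro i j h _ ⟨n, hn, rfl⟩
      exact (congrArg q (N.proj_ne hn h)).trans (map_zero q)
    · intro m
      obtain ⟨n, rfl⟩ := Submodule.mkQ_surjective _ m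
      obtain ⟨s, hs⟩ := N.exists_eq_sum_proj n
      rw [hs, map_sum]
      exact sum_mem fun i _ => AddSubgroup.mem_iSup_of_mem i ⟨_, N.proj_mem i n, rfl⟩
  smul_mem := by
    rintro i j a _ ha ⟨n, hn, rfl⟩
    exact ⟨a • n, N.smul_mem ha hn, rfl⟩

/-- The projection to the cokernel. -/
noncomputable def cokerπ {M N : GrMod 𝒜} (f : M ⟶ N) : N ⟶ coker f :=
  ofLin (LinearMap.range (Hom.lin f)).mkQ fun h => ⟨_, h, rfl⟩

theorem comp_cokerπ {M N : GrMod 𝒜} (f : M ⟶ N) : f ≫ cokerπ f = 0 :=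
  hom_ext fun m => (Submodule.Quotient.mk_eq_zero _).2 ⟨m, rfl⟩

theorem injective_of_mono {M N : GrMod 𝒜} (f : M ⟶ N) [Mono f] :
    Function.Injective (Hom.lin f) := by
  rw [← LinearMap.ker_eq_bot, eq_bot_iff]
  intro m hm
  have h : kerι f = 0 := by
    rw [← cancel_mono f, kerι_comp, Limits.zero_comp]
  exact congr_lin h ⟨m, hm⟩

theorem surjective_of_epi {M N : GrMod 𝒜} (f : M ⟶ N) [Epi f] :
    Function.Surjective (Hom.lin f) := by
  rw [← LinearMap.range_eq_top, eq_top_iff]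
  intro n _
  have h : cokerπ f = 0 := by
    rw [← cancel_epi f, comp_cokerπ, Limits.comp_zero]
  exact (Submodule.Quotient.mk_eq_zero _).1 (congr_lin h n)

/-- `h` factors through the surjection `f` if it vanishes on the kernel of `f`. -/
noncomputable def factorSurj {M N P : GrMod 𝒜} (f : M ⟶ N)
    (hf : Function.Surjective (Hom.lin f)) (h : M ⟶ P)
    (hk : LinearMap.ker (Hom.lin f) ≤ LinearMap.ker (Hom.lin h)) : N ⟶ P :=
  ofLin ((LinearMap.ker (Hom.lin f)).liftQ (Hom.lin h) hk ∘ₗ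
      ((Hom.lin f).quotKerEquivOfSurjective hf).symm.toLinearMap) (by
    intro i n hn
    obtain ⟨m, hm, rfl⟩ := exists_mem_of_surjective f hf hn
    have : ((Hom.lin f).quotKerEquivOfSurjective hf).symm (Hom.lin f m) =
        (LinearMap.ker (Hom.lin f)).mkQ m := by
      rw [LinearEquiv.symm_apply_eq]
      rfl
    rw [LinearMap.comp_apply, LinearEquiv.coe_coe, this]
    exact lin_mem h hm)

theorem factorSurj_fac {M N P : GrMod 𝒜} (f : M ⟶ N)
    (hf : Function.Surjective (Hom.lin f)) (h : M ⟶ P)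
    (hk : LinearMap.ker (Hom.lin f) ≤ LinearMap.ker (Hom.lin h)) :
    f ≫ factorSurj f hf h hk = h := by
  refine hom_ext fun m => ?_
  have : ((Hom.lin f).quotKerEquivOfSurjective hf).symm (Hom.lin f m) =
      (LinearMap.ker (Hom.lin f)).mkQ m := by
    rw [LinearEquiv.symm_apply_eq]
    rfl
  change (LinearMap.ker (Hom.lin f)).liftQ (Hom.lin h) hk
    (((Hom.lin f).quotKerEquivOfSurjective hf).symm (Hom.lin f m)) = _
  rw [this]
  rfl

/-- `h` factors through the injection `f` if its image is contained in the image of `f`. -/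
noncomputable def factorInj {M N P : GrMod 𝒜} (f : M ⟶ N)
    (hf : Function.Injective (Hom.lin f)) (h : P ⟶ N)
    (hr : ∀ p, Hom.lin h p ∈ LinearMap.range (Hom.lin f)) : P ⟶ M :=
  ofLin ((LinearEquiv.ofInjective (Hom.lin f) hf).symm.toLinearMap ∘ₗ
      (Hom.lin h).codRestrict _ hr) (by
    intro i p hp
    refine mem_of_lin_mem f hf ?_
    have := LinearEquiv.apply_symm_apply (LinearEquiv.ofInjective (Hom.lin f) hf)
      ⟨Hom.lin h p, hr p⟩
    have e := congrArg Subtype.val this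
    rw [LinearEquiv.ofInjective_apply] at e
    exact e ▸ lin_mem h hp)

theorem factorInj_fac {M N P : GrMod 𝒜} (f : M ⟶ N)
    (hf : Function.Injective (Hom.lin f)) (h : P ⟶ N)
    (hr : ∀ p, Hom.lin h p ∈ LinearMap.range (Hom.lin f)) :
    factorInj f hf h hr ≫ f = h := by
  refine hom_ext fun p => ?_
  have := LinearEquiv.apply_symm_apply (LinearEquiv.ofInjective (Hom.lin f) hf)
    ⟨Hom.lin h p, hr p⟩
  have e := congrArg Subtype.val this
  rw [LinearEquiv.ofInjective_apply] at e
  exact e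

theorem mono_of_injective {M N : GrMod 𝒜} (f : M ⟶ N) (hf : Function.Injective (Hom.lin f)) :
    Mono f := ⟨fun _ _ e => hom_ext fun m => hf (congr_lin e m)⟩

theorem epi_of_surjective {M N : GrMod 𝒜} (f : M ⟶ N) (hf : Function.Surjective (Hom.lin f)) :
    Epi f := ⟨fun _ _ e => hom_ext fun n => by
      obtain ⟨m, rfl⟩ := hf n
      exact congr_lin e m⟩

theorem kerι_injective {M N : GrMod 𝒜} (f : M ⟶ N) : Function.Injective (Hom.lin (kerι f)) :=
  Subtype.val_injective

theorem cokerπ_surjective {M N : GrMod 𝒜} (f : M ⟶ N) :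
    Function.Surjective (Hom.lin (cokerπ f)) :=
  Submodule.mkQ_surjective _

/-- If `f` is injective with image the kernel of `g`, then `f` is a kernel of `g`. -/
noncomputable def isLimitOfInjective {M N P : GrMod 𝒜} (f : M ⟶ N) (g : N ⟶ P) (w : f ≫ g = 0)
    (hf : Function.Injective (Hom.lin f))
    (h : ∀ n, Hom.lin g n = 0 → n ∈ LinearMap.range (Hom.lin f)) :
    Limits.IsLimit (Limits.KernelFork.ofι f w) :=
  haveI := mono_of_injective f hf
  Limits.KernelFork.IsLimit.ofι f w
    (fun t ht => factorInj f hf t fun p => h _ (congr_lin ht p))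
    (fun t ht => factorInj_fac _ _ _ _)
    (fun t ht m hm => by rw [← cancel_mono f, hm, factorInj_fac])

/-- If `g` is surjective with kernel contained in the image of `f`, then `g` is a cokernel
of `f`. -/
noncomputable def isColimitOfSurjective {M N P : GrMod 𝒜} (f : M ⟶ N) (g : N ⟶ P)
    (w : f ≫ g = 0) (hg : Function.Surjective (Hom.lin g))
    (h : ∀ n, Hom.lin g n = 0 → n ∈ LinearMap.range (Hom.lin f)) :
    Limits.IsColimit (Limits.CokernelCofork.ofπ g w) :=
  haveI := epi_of_surjective g hg
  Limits.CokernelCofork.IsColimit.ofπ g w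
    (fun t ht => factorSurj g hg t fun n hn => by
      obtain ⟨m, rfl⟩ := h n hn
      exact congr_lin ht m)
    (fun t ht => factorSurj_fac _ _ _ _)
    (fun t ht m hm => by rw [← cancel_epi g, hm, factorSurj_fac])

instance : Limits.HasKernels (GrMod 𝒜) where
  has_limit f := ⟨⟨_, isLimitOfInjective (kerι f) f (kerι_comp f) (kerι_injective f)
    fun n hn => ⟨⟨n, hn⟩, rfl⟩⟩⟩

instance : Limits.HasCokernels (GrMod 𝒜) where
  has_colimit f := ⟨⟨_, isColimitOfSurjective f (cokerπ f) (comp_cokerπ f) (cokerπ_surjective f)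
    fun _ hn => (Submodule.Quotient.mk_eq_zero _).1 hn⟩⟩

/-- The direct sum of two graded modules. -/
def prod (M N : GrMod 𝒜) : GrMod 𝒜 where
  carrier := M.carrier × N.carrier
  deg i := (M.deg i).prod (N.deg i)
  isInternal := by
    refine isInternal_of_proj (fun i => (M.proj i).prodMap (N.proj i))
      (fun i m hm => Prod.ext (M.proj_same hm.1) (N.proj_same hm.2))
      (fun i j h m hm => Prod.ext (M.proj_ne hm.1 h) (N.proj_ne hm.2 h)) fun m => ?_
    obtain ⟨s, hs⟩ := M.exists_eq_sum_proj m.1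
    obtain ⟨t, ht⟩ := N.exists_eq_sum_proj m.2
    have : m = (∑ i ∈ s, ((M.proj i m.1, 0) : M.carrier × N.carrier)) +
        ∑ i ∈ t, ((0, N.proj i m.2) : M.carrier × N.carrier) := by
      refine Prod.ext ?_ ?_
      · simpa [Prod.fst_sum] using hs
      · simpa [Prod.snd_sum] using ht
    rw [this]
    exact add_mem
      (sum_mem fun i _ => AddSubgroup.mem_iSup_of_mem i ⟨M.proj_mem i m.1, zero_mem _⟩)
      (sum_mem fun i _ => AddSubgroup.mem_iSup_of_mem i ⟨zero_mem _, N.proj_mem i m.2⟩)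
  smul_mem ha hm := ⟨M.smul_mem ha hm.1, N.smul_mem ha hm.2⟩

instance : Limits.HasBinaryProducts (GrMod 𝒜) :=
  haveI : ∀ {M N : GrMod 𝒜}, Limits.HasLimit (Limits.pair M N) := fun {M N} =>
    ⟨⟨_, Limits.BinaryFan.isLimitMk (W := prod M N)
      (fst := ofLin (LinearMap.fst Λ M.carrier N.carrier) fun h => h.1)
      (snd := ofLin (LinearMap.snd Λ M.carrier N.carrier) fun h => h.2)
      (fun s => ofLin ((Hom.lin s.fst).prod (Hom.lin s.snd))
        fun h => ⟨lin_mem s.fst h, lin_mem s.snd h⟩)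
      (fun _ => hom_ext fun _ => rfl) (fun _ => hom_ext fun _ => rfl)
      (fun _ _ h₁ h₂ => hom_ext fun x => Prod.ext (congr_lin h₁ x) (congr_lin h₂ x))⟩⟩
  Limits.hasBinaryProducts_of_hasLimit_pair _

variable (𝒜) in
/-- The zero graded module. -/
def zero : GrMod 𝒜 where
  carrier := PUnit
  deg _ := ⊥
  isInternal := isInternal_of_proj (fun _ => 0) (fun _ _ _ => rfl) (fun _ _ _ _ _ => rfl)
    fun _ => zero_mem _
  smul_mem _ _ := rfl

theorem isZero_zero : Limits.IsZero (zero 𝒜) := by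
  rw [Limits.IsZero.iff_id_eq_zero]
  exact hom_ext fun m => rfl

instance : Limits.HasZeroObject (GrMod 𝒜) := ⟨⟨_, isZero_zero⟩⟩

/-- `Gr Λ` is an abelian category. -/
instance : Abelian (GrMod 𝒜) where
  normalMonoOfMono f _ :=
    ⟨{ Z := coker f
       g := cokerπ f
       w := comp_cokerπ f
       isLimit := isLimitOfInjective f (cokerπ f) (comp_cokerπ f) (injective_of_mono f)
        fun _ hn => (Submodule.Quotient.mk_eq_zero _).1 hn }⟩
  normalEpiOfEpi f _ :=
    ⟨{ W := ker f
       g := kerι f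
       w := kerι_comp f
       isColimit := isColimitOfSurjective (kerι f) f (kerι_comp f) (surjective_of_epi f)
        fun n hn => ⟨⟨n, hn⟩, rfl⟩ }⟩
  has_finite_products := hasFiniteProducts_of_has_binary_and_terminal

/-! ### Graded free modules; enough projectives -/

/-- The component of degree `n ∈ ℤ` in `Λ` (zero for `n < 0`). -/
noncomputable def coeff (𝒜 : ℕ → Submodule k Λ) [GradedAlgebra 𝒜] (n : ℤ) : Λ →+ Λ :=
  if 0 ≤ n then
    { toFun := fun a => (DirectSum.decompose 𝒜 a n.toNat : Λ)
      map_zero' := by simp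
      map_add' := by simp }
  else 0

theorem coeff_of_mem_same {i : ℕ} {n : ℤ} (h : (i : ℤ) = n) {a : Λ} (ha : a ∈ 𝒜 i) :
    coeff 𝒜 n a = a := by
  subst h
  rw [coeff, if_pos (by omega)]
  exact DirectSum.decompose_of_mem_same 𝒜 ha

theorem coeff_of_mem_ne {i : ℕ} {n : ℤ} (h : (i : ℤ) ≠ n) {a : Λ} (ha : a ∈ 𝒜 i) :
    coeff 𝒜 n a = 0 := by
  rw [coeff]
  split_ifs with h0
  · exact DirectSum.decompose_of_mem_ne 𝒜 ha (by omega)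
  · rfl

theorem coeff_mem {i : ℕ} {n : ℤ} (h : (i : ℤ) = n) (a : Λ) : coeff 𝒜 n a ∈ 𝒜 i := by
  subst h
  rw [coeff, if_pos (by omega)]
  exact (DirectSum.decompose 𝒜 a _).2

theorem coeff_neg {n : ℤ} (h : n < 0) (a : Λ) : coeff 𝒜 n a = 0 := by
  rw [coeff, if_neg (by omega)]
  rfl

theorem coeff_coeff_ne {n m : ℤ} (h : m ≠ n) (a : Λ) : coeff 𝒜 n (coeff 𝒜 m a) = 0 := by
  by_cases hm : 0 ≤ m
  · obtain ⟨i, rfl⟩ := Int.eq_ofNat_of_zero_le hm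
    exact coeff_of_mem_ne h (coeff_mem rfl a)
  · rw [coeff_neg (n := m) (by omega), map_zero]

theorem coeff_mul {i : ℕ} {b : Λ} (hb : b ∈ 𝒜 i) (n : ℤ) {a : Λ} (ha : coeff 𝒜 n a = a) :
    coeff 𝒜 (i + n) (b * a) = b * a := by
  by_cases hn : 0 ≤ n
  · obtain ⟨j, rfl⟩ := Int.eq_ofNat_of_zero_le hn
    refine coeff_of_mem_same (i := i + j) (by push_cast; rfl) (SetLike.GradedMul.mul_mem hb ?_)
    rw [← ha]
    exact coeff_mem rfl a
  · rw [coeff_neg (by omega)] at ha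
    rw [← ha, mul_zero, map_zero]

/-- The graded free module on a set `S` of generators, the generator `s` having degree `d s`. -/
noncomputable def free (𝒜 : ℕ → Submodule k Λ) [GradedAlgebra 𝒜] {S : Type u} (d : S → ℤ) :
    GrMod 𝒜 where
  carrier := S →₀ Λ
  deg n :=
    { carrier := {f | ∀ s, coeff 𝒜 (n - d s) (f s) = f s}
      zero_mem' := fun s => by simp
      add_mem' := fun {f g} hf hg s => by rw [Finsupp.add_apply, map_add, hf s, hg s]
      neg_mem' := fun {f} hf s => by rw [Finsupp.neg_apply, map_neg, hf s] }
  isInternal := by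
    classical
    have key : ∀ (n : ℤ) (f : S →₀ Λ) (s : S), f s = 0 → coeff 𝒜 (n - d s) (f s) = 0 :=
      fun n f s h => by rw [h, map_zero]
    refine isInternal_of_proj
      (fun n => AddMonoidHom.mk' (fun f => Finsupp.onFinset f.support
        (fun s => coeff 𝒜 (n - d s) (f s)) fun s hs => by
          rw [Finsupp.mem_support_iff]
          exact fun h => hs (key n f s h)) fun f g => ?_) ?_ ?_ ?_
    · ext s
      simp
    · intro n f hf
      ext s
      exact hf s
    · intro n m h f hf
      ext s
      change coeff 𝒜 (n - d s) (f s) = 0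
      rw [← hf s]
      exact coeff_coeff_ne (by omega) _
    · intro f
      induction f using Finsupp.induction_linear with
      | zero => exact zero_mem _
      | add f g hf hg => exact add_mem hf hg
      | single s a =>
        rw [← DirectSum.sum_support_decompose 𝒜 a, Finsupp.single_finsetSum]
        refine sum_mem fun i _ => AddSubgroup.mem_iSup_of_mem ((i : ℤ) + d s) fun t => ?_
        by_cases h : s = t
        · subst h
          rw [Finsupp.single_eq_same]
          exact coeff_of_mem_same (i := i) (by omega) (DirectSum.decompose 𝒜 a i).2
        · rw [Finsupp.single_eq_of_ne' h, map_zero]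
  smul_mem := by
    intro i j a f ha hf s
    rw [Finsupp.smul_apply, smul_eq_mul, add_sub_assoc]
    exact coeff_mul ha _ (hf s)

/-- The morphism from a graded free module determined by homogeneous elements of the
right degrees. -/
noncomputable def freeDesc {S : Type u} (d : S → ℤ) (M : GrMod 𝒜) (m : S → M.carrier)
    (hm : ∀ s, m s ∈ M.deg (d s)) : free 𝒜 d ⟶ M :=
  ofLin (M := free 𝒜 d) (Finsupp.linearCombination Λ m) (by
    intro n (f : S →₀ Λ) hf
    refine (congrArg (· ∈ M.deg n) (Finsupp.linearCombination_apply Λ (v := m) f)).mpr ?_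
    refine sum_mem fun s _ => ?_
    have hs : coeff 𝒜 (n - d s) (f s) = f s := hf s
    change f s • m s ∈ _
    by_cases h : 0 ≤ n - d s
    · obtain ⟨i, hi⟩ := Int.eq_ofNat_of_zero_le h
      have := M.smul_mem (coeff_mem (𝒜 := 𝒜) hi.symm (f s)) (hm s)
      rwa [hs, ← hi, sub_add_cancel] at this
    · rw [← hs, coeff_neg (by omega), zero_smul]
      exact zero_mem _)

theorem freeDesc_single {S : Type u} (d : S → ℤ) (M : GrMod 𝒜) (m : S → M.carrier)
    (hm : ∀ s, m s ∈ M.deg (d s)) (s : S) :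
    Hom.lin (freeDesc d M m hm) (Finsupp.single s (1 : Λ)) = m s := by
  change Finsupp.linearCombination Λ m (Finsupp.single s (1 : Λ)) = m s
  rw [Finsupp.linearCombination_single, one_smul]

theorem single_mem_free {S : Type u} (d : S → ℤ) (s : S) :
    (Finsupp.single s (1 : Λ) : S →₀ Λ) ∈ (free 𝒜 d).deg (d s) := by
  classical
  intro t
  by_cases h : s = t
  · subst h
    rw [Finsupp.single_eq_same]
    exact coeff_of_mem_same (i := 0) (by simp) SetLike.GradedOne.one_mem
  · rw [Finsupp.single_eq_of_ne' h, map_zero]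

theorem free_hom_ext {S : Type u} {d : S → ℤ} {M : GrMod 𝒜} {f g : free 𝒜 d ⟶ M}
    (h : ∀ s, Hom.lin f (Finsupp.single s (1 : Λ)) = Hom.lin g (Finsupp.single s (1 : Λ))) :
    f = g := by
  refine Hom.ext (Finsupp.lhom_ext fun s a => ?_)
  have : (Finsupp.single s a : S →₀ Λ) = a • Finsupp.single s 1 := by
    rw [Finsupp.smul_single, smul_eq_mul, mul_one]
  rw [this]
  exact ((Hom.lin f).map_smul a _).trans
    ((congrArg (a • ·) (h s)).trans ((Hom.lin g).map_smul a _).symm)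

instance projective_free {S : Type u} (d : S → ℤ) : Projective (free 𝒜 d) where
  factors {E X} f e _ := by
    have := fun s => exists_mem_of_surjective e (surjective_of_epi e)
      (lin_mem f (single_mem_free (𝒜 := 𝒜) d s))
    choose m hm hm' using this
    refine ⟨freeDesc d E m hm, free_hom_ext fun s => ?_⟩
    exact (congrArg (Hom.lin e) (freeDesc_single d E m hm s)).trans (hm' s)

instance : EnoughProjectives (GrMod 𝒜) where
  presentation M :=
    ⟨{ p := free 𝒜 (S := Σ i : ℤ, M.deg i) fun x => x.1
       f := freeDesc _ M (fun x => x.2) fun x => x.2.2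
       epi := epi_of_surjective _ fun m => by
        obtain ⟨s, hs⟩ := M.exists_eq_sum_proj m
        refine ⟨∑ i ∈ s, Finsupp.single ⟨i, ⟨M.proj i m, M.proj_mem i m⟩⟩ (1 : Λ), ?_⟩
        conv_rhs => rw [hs]
        refine (map_sum (Hom.lin _) _ _).trans (Finset.sum_congr rfl fun i _ => ?_)
        rw [freeDesc_single] }⟩

instance : HasExt.{u} (GrMod 𝒜) := hasExt_of_enoughProjectives.{u} _

/-! ### Forgetting the grading, and shifting it -/

variable (𝒜) in
/-- The functor `Gr Λ ⥤ Mod Λ` forgetting the grading. -/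
def forget : GrMod 𝒜 ⥤ ModuleCat.{u} Λ where
  obj M := ModuleCat.of Λ M.carrier
  map f := ModuleCat.ofHom (Hom.lin f)

/-- The graded shift `M⟨j⟩`, with `(M⟨j⟩)_i = M_{i-j}`. -/
def shiftObj (j : ℤ) (M : GrMod 𝒜) : GrMod 𝒜 where
  carrier := M.carrier
  deg i := M.deg (i - j)
  isInternal := isInternal_of_proj (fun i => M.proj (i - j)) (fun i m hm => M.proj_same hm)
    (fun i l h m hm => M.proj_ne hm (by omega)) fun m => by
      obtain ⟨s, hs⟩ := M.exists_eq_sum_proj m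
      rw [hs]
      refine sum_mem fun i _ => AddSubgroup.mem_iSup_of_mem (i + j) ?_
      rw [add_sub_cancel_right]
      exact M.proj_mem i m
  smul_mem {i l a m} ha hm := by
    rw [add_sub_assoc]
    exact M.smul_mem ha hm

variable (𝒜) in
/-- The functor `M ↦ M⟨j⟩`. -/
def shift (j : ℤ) : GrMod 𝒜 ⥤ GrMod 𝒜 where
  obj M := shiftObj j M
  map {M N} f := ofLin (M := shiftObj j M) (N := shiftObj j N) (Hom.lin (M := M) (N := N) f)
    fun {i m} (h : m ∈ M.deg (i - j)) => lin_mem f h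

instance (j : ℤ) : (shift 𝒜 j).Additive where
  map_add := rfl

instance (j : ℤ) : (shift 𝒜 j).Linear k where
  map_smul _ _ := rfl

/-- The canonical isomorphism `M⟨i⟩⟨j⟩ ≅ M⟨n⟩` for `i + j = n`: the identity of `M`. -/
def shiftShift (M : GrMod 𝒜) {i j n : ℤ} (h : i + j = n) :
    (shift 𝒜 j).obj ((shift 𝒜 i).obj M) ≅ (shift 𝒜 n).obj M where
  hom := ofLin (M := shiftObj j (shiftObj i M)) (N := shiftObj n M) LinearMap.id
    fun {l m} (hm : m ∈ M.deg (l - j - i)) =>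
      show m ∈ M.deg (l - n) by rwa [← h, add_comm, ← sub_sub]
  inv := ofLin (M := shiftObj n M) (N := shiftObj j (shiftObj i M)) LinearMap.id
    fun {l m} (hm : m ∈ M.deg (l - n)) =>
      show m ∈ M.deg (l - j - i) by rwa [sub_sub, add_comm j i, h]

/-- The canonical isomorphism `M⟨0⟩ ≅ M`: the identity of `M`. -/
def shiftZero (M : GrMod 𝒜) {n : ℤ} (h : n = 0) : (shift 𝒜 n).obj M ≅ M where
  hom := ofLin (M := shiftObj n M) (N := M) LinearMap.id
    fun {l m} (hm : m ∈ M.deg (l - n)) => by rwa [h, sub_zero] at hm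
  inv := ofLin (M := M) (N := shiftObj n M) LinearMap.id
    fun {l m} (hm : m ∈ M.deg l) => show m ∈ M.deg (l - n) by rwa [h, sub_zero]

variable (𝒜) in
/-- The shift by `j` is an autoequivalence of `Gr Λ`, with quasi-inverse the shift by `-j`. -/
def shiftEquiv (j : ℤ) : GrMod 𝒜 ≌ GrMod 𝒜 where
  functor := shift 𝒜 j
  inverse := shift 𝒜 (-j)
  unitIso := NatIso.ofComponents
    (fun M => (shiftShift M (add_neg_cancel j) ≪≫ shiftZero M rfl).symm) fun _ => rfl
  counitIso := NatIso.ofComponents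
    (fun M => shiftShift M (neg_add_cancel j) ≪≫ shiftZero M rfl) fun _ => rfl

instance (j : ℤ) : (shift 𝒜 j).IsEquivalence := (shiftEquiv 𝒜 j).isEquivalence_functor

end

end GrMod

/-! ### Extension algebras -/

section ExtAlgebra

open Abelian

variable {k : Type v} [Field k]

/-- The graded pieces `Ext^i_C(X, X)`, `i ≥ 0`, of the extension algebra of an object `X` of a
`k`-linear abelian category `C`. -/
def SelfExt {C : Type*} [Category* C] [Abelian C] [HasExt.{u} C] (X : C) (i : ℕ) : Type u :=
  Ext.{u} X X i

namespace SelfExt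

variable {C : Type*} [Category* C] [Abelian C] [HasExt.{u} C] (X : C)

noncomputable instance (i : ℕ) : AddCommGroup (SelfExt X i) :=
  inferInstanceAs (AddCommGroup (Ext X X i))

noncomputable instance [Linear k C] (i : ℕ) : Module k (SelfExt X i) :=
  inferInstanceAs (Module k (Ext X X i))

variable {X}

/-- The Yoneda product `x y = x ∘ y`: first `y`, then `x`. -/
noncomputable def mul {i j n : ℕ} (x : SelfExt X i) (y : SelfExt X j) (h : i + j = n) :
    SelfExt X n :=
  Ext.comp (X := X) (Y := X) (Z := X) y x ((add_comm j i).trans h)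

variable (X) in
/-- The identity of `X`. -/
noncomputable def one : SelfExt X 0 := Ext.mk₀ (𝟙 X)

theorem mk_mul {i j n : ℕ} (x : SelfExt X i) (y : SelfExt X j) (h : i + j = n) :
    GradedMonoid.mk (A := SelfExt X) (i + j) (mul x y rfl) = GradedMonoid.mk n (mul x y h) := by
  subst h
  rfl

noncomputable instance : GradedMonoid.GOne (SelfExt X) := ⟨one X⟩

noncomputable instance : GradedMonoid.GMul (SelfExt X) := ⟨fun x y => mul x y rfl⟩

noncomputable instance : DirectSum.GSemiring (SelfExt X) where
  mul_zero _ := Ext.zero_comp _ _ _ _ (add_comm _ _)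
  zero_mul _ := Ext.comp_zero _ _ _ _ (add_comm _ _)
  mul_add _ _ _ := Ext.add_comp _ _ _ (add_comm _ _)
  add_mul _ _ _ := Ext.comp_add _ _ _ (add_comm _ _)
  one_mul a := (mk_mul (one X) a.2 (zero_add _)).trans
    (congrArg (GradedMonoid.mk (A := SelfExt X) a.1) (Ext.comp_mk₀_id _))
  mul_one a := (mk_mul a.2 (one X) (add_zero _)).trans
    (congrArg (GradedMonoid.mk (A := SelfExt X) a.1) (Ext.mk₀_id_comp _))
  mul_assoc a b c := (mk_mul (mul a.2 b.2 rfl) c.2 rfl).trans <| by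
    refine Eq.trans ?_ (mk_mul a.2 (mul b.2 c.2 rfl) (add_assoc _ _ _).symm).symm
    refine congrArg (GradedMonoid.mk (A := SelfExt X) (a.1 + b.1 + c.1)) ?_
    exact (Ext.comp_assoc _ _ _ _ _ (by omega)).symm
  natCast n := n • one X
  natCast_zero := zero_nsmul _
  natCast_succ n := succ_nsmul _ n

variable (k X) in
/-- The structure map `k → Ext^0(X, X)`, sending `c` to `c` times the identity. -/
noncomputable def scalar [Linear k C] : k →+ SelfExt X 0 where
  toFun c := c • one X
  map_zero' := zero_smul _ _
  map_add' a b := add_smul a b _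

noncomputable instance [Linear k C] : DirectSum.GAlgebra k (SelfExt X) where
  toFun := scalar k X
  map_one := by
    change (1 : k) • one X = one X
    exact one_smul k (one X)
  map_mul a b := by
    refine Eq.trans ?_ (mk_mul (a • one X) (b • one X) (add_zero 0)).symm
    refine congrArg (GradedMonoid.mk (A := SelfExt X) 0) ?_
    refine Eq.trans ?_ (Ext.comp_smul _ _ _ a).symm
    refine (mul_smul a b (one X)).trans (congrArg (a • ·) ?_)
    exact (Ext.comp_mk₀_id (b • one X : Ext X X 0)).symm
  commutes c x := by
    refine (mk_mul (c • one X) x.2 (zero_add _)).trans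
      (Eq.trans ?_ (mk_mul x.2 (c • one X) (add_zero _)).symm)
    refine congrArg (GradedMonoid.mk (A := SelfExt X) x.1) ?_
    refine (Ext.comp_smul _ _ _ c).trans (Eq.trans ?_ (Ext.smul_comp _ _ _ c).symm)
    exact congrArg (c • ·) ((Ext.comp_mk₀_id _).trans (Ext.mk₀_id_comp _).symm)
  smul_def c x := by
    refine Eq.trans ?_ (mk_mul (c • one X) x.2 (zero_add _)).symm
    refine congrArg (GradedMonoid.mk (A := SelfExt X) x.1) ?_
    refine Eq.trans ?_ (Ext.comp_smul _ _ _ c).symm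
    exact congrArg (c • ·) (Ext.comp_mk₀_id _).symm

end SelfExt

namespace GrMod

variable {Λ : Type u} [Ring Λ] [Algebra k Λ] {𝒜 : ℕ → Submodule k Λ} [GradedAlgebra 𝒜]

/-- Decomposition of an extension class of positive degree into a connecting class and a class
of smaller degree. -/
theorem exists_extClass_comp {C : Type*} [Category* C] [Abelian C] [EnoughProjectives C]
    [HasExt.{u} C] {X Y : C} {n : ℕ} (x : Ext X Y (n + 1)) :
    ∃ (S : ShortComplex C) (hS : S.ShortExact) (e : S.X₃ = X) (y : Ext S.X₁ Y n),
      x = e ▸ hS.extClass.comp y (add_comm 1 n) := by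
  let S := ShortComplex.mk _ _ (Limits.kernel.condition (Projective.π X))
  have hS : S.ShortExact :=
    { exact := ShortComplex.exact_of_f_is_kernel _ (Limits.kernelIsKernel S.g) }
  obtain ⟨y, hy⟩ := Ext.contravariant_sequence_exact₃ hS Y x (Ext.eq_zero_of_projective _)
    (add_comm 1 n)
  exact ⟨S, hS, rfl, y, hy.symm⟩

/-- Extension classes are compatible with the isomorphisms `M⟨i⟩⟨j⟩ ≅ M⟨i+j⟩`. -/
theorem map_shift_shift {X Y : GrMod 𝒜} {a : ℕ} (x : Ext X Y a) {i j n : ℤ} (h : i + j = n) :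
    ((x.mapExactFunctor (shift 𝒜 i)).mapExactFunctor (shift 𝒜 j)).comp
        (Ext.mk₀ (shiftShift Y h).hom) (add_zero a) =
      (Ext.mk₀ (shiftShift X h).hom).comp (x.mapExactFunctor (shift 𝒜 n)) (zero_add a) := by
  induction a generalizing X with
  | zero =>
    obtain ⟨f, rfl⟩ := (Ext.mk₀_bijective X Y).2 x
    simp only [Ext.mapExactFunctor_mk₀, Ext.mk₀_comp_mk₀]
    rfl
  | succ a ih =>
    obtain ⟨S, hS, rfl, y, rfl⟩ := exists_extClass_comp x
    have hcls : ((hS.extClass.mapExactFunctor (shift 𝒜 i)).mapExactFunctor (shift 𝒜 j)).comp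
          (Ext.mk₀ (shiftShift S.X₁ h).hom) (add_zero 1) =
        (Ext.mk₀ (shiftShift S.X₃ h).hom).comp
          (hS.extClass.mapExactFunctor (shift 𝒜 n)) (zero_add 1) := by
      rw [Ext.mapExactFunctor_extClass, Ext.mapExactFunctor_extClass]
      refine Eq.trans (congrArg (fun z => Ext.comp z _ _)
        (Ext.mapExactFunctor_extClass (shift 𝒜 j) (hS.map_of_exact (shift 𝒜 i)))) ?_
      exact (ShortComplex.ShortExact.extClass_naturality
        ((hS.map_of_exact (shift 𝒜 i)).map_of_exact (shift 𝒜 j)) (hS.map_of_exact (shift 𝒜 n))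
        { τ₁ := (shiftShift S.X₁ h).hom
          τ₂ := (shiftShift S.X₂ h).hom
          τ₃ := (shiftShift S.X₃ h).hom
          comm₁₂ := rfl
          comm₂₃ := rfl })
    simp only [Ext.mapExactFunctor_comp]
    rw [Ext.comp_assoc_of_third_deg_zero, ih, ← Ext.comp_assoc_of_second_deg_zero, hcls,
      Ext.comp_assoc _ _ _ (zero_add 1) (add_comm 1 a) (by omega)]

/-- Extension classes are compatible with the isomorphisms `M⟨0⟩ ≅ M`. -/
theorem map_shift_zero {X Y : GrMod 𝒜} {a : ℕ} (x : Ext X Y a) {n : ℤ} (h : n = 0) :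
    (x.mapExactFunctor (shift 𝒜 n)).comp (Ext.mk₀ (shiftZero Y h).hom) (add_zero a) =
      (Ext.mk₀ (shiftZero X h).hom).comp x (zero_add a) := by
  induction a generalizing X with
  | zero =>
    obtain ⟨f, rfl⟩ := (Ext.mk₀_bijective X Y).2 x
    simp only [Ext.mapExactFunctor_mk₀, Ext.mk₀_comp_mk₀]
    rfl
  | succ a ih =>
    obtain ⟨S, hS, rfl, y, rfl⟩ := exists_extClass_comp x
    have hcls : (hS.extClass.mapExactFunctor (shift 𝒜 n)).comp
          (Ext.mk₀ (shiftZero S.X₁ h).hom) (add_zero 1) =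
        (Ext.mk₀ (shiftZero S.X₃ h).hom).comp hS.extClass (zero_add 1) := by
      rw [Ext.mapExactFunctor_extClass]
      exact (ShortComplex.ShortExact.extClass_naturality (hS.map_of_exact (shift 𝒜 n)) hS
        { τ₁ := (shiftZero S.X₁ h).hom
          τ₂ := (shiftZero S.X₂ h).hom
          τ₃ := (shiftZero S.X₃ h).hom
          comm₁₂ := rfl
          comm₂₃ := rfl })
    simp only [Ext.mapExactFunctor_comp]
    rw [Ext.comp_assoc_of_third_deg_zero, ih, ← Ext.comp_assoc_of_second_deg_zero, hcls,
      Ext.comp_assoc _ _ _ (zero_add 1) (add_comm 1 a) (by omega)]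

/-- The product of `x ∈ Ext^i(T, T⟨i⟩)` and `y ∈ Ext^j(T, T⟨j⟩)`: the Yoneda composite of
`y : T → T⟨j⟩[j]` and `x⟨j⟩ : T⟨j⟩ → T⟨i⟩⟨j⟩[i] = T⟨i+j⟩[i]`. -/
noncomputable def extMul {T : GrMod 𝒜} {i j n : ℕ} (x : Ext T ((shift 𝒜 i).obj T) i)
    (y : Ext T ((shift 𝒜 j).obj T) j) (h : i + j = n) : Ext T ((shift 𝒜 n).obj T) n :=
  y.comp ((x.mapExactFunctor (shift 𝒜 j)).comp
    (Ext.mk₀ (shiftShift T (i := i) (j := j) (n := n) (by omega)).hom) (add_zero i))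
    ((add_comm j i).trans h)

/-- The identity of `T`, as an element of `Ext^0(T, T⟨0⟩)`. -/
noncomputable def extOne (T : GrMod 𝒜) : Ext T ((shift 𝒜 (0 : ℕ)).obj T) 0 :=
  Ext.mk₀ (shiftZero T (Nat.cast_zero (R := ℤ))).inv

section

variable {T : GrMod 𝒜} {i j n : ℕ}

theorem extMul_add (x : Ext T ((shift 𝒜 i).obj T) i) (y z : Ext T ((shift 𝒜 j).obj T) j)
    (h : i + j = n) : extMul x (y + z) h = extMul x y h + extMul x z h := Ext.add_comp _ _ _ _

theorem add_extMul (x y : Ext T ((shift 𝒜 i).obj T) i) (z : Ext T ((shift 𝒜 j).obj T) j)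
    (h : i + j = n) : extMul (x + y) z h = extMul x z h + extMul y z h := by
  simp only [extMul, Ext.mapExactFunctor_add, Ext.add_comp, Ext.comp_add]

theorem extMul_zero (x : Ext T ((shift 𝒜 i).obj T) i) (h : i + j = n) :
    extMul x (0 : Ext T ((shift 𝒜 j).obj T) j) h = 0 := Ext.zero_comp _ _ _ _ _

theorem zero_extMul (y : Ext T ((shift 𝒜 j).obj T) j) (h : i + j = n) :
    extMul (0 : Ext T ((shift 𝒜 i).obj T) i) y h = 0 := by
  simp only [extMul, Ext.mapExactFunctor_zero, Ext.zero_comp, Ext.comp_zero]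

theorem extMul_smul (c : k) (x : Ext T ((shift 𝒜 i).obj T) i)
    (y : Ext T ((shift 𝒜 j).obj T) j) (h : i + j = n) :
    extMul x (c • y) h = c • extMul x y h := Ext.smul_comp _ _ _ c

theorem smul_extMul (c : k) (x : Ext T ((shift 𝒜 i).obj T) i)
    (y : Ext T ((shift 𝒜 j).obj T) j) (h : i + j = n) :
    extMul (c • x) y h = c • extMul x y h := by
  simp only [extMul, Functor.mapExactFunctor_smul, Ext.smul_comp, Ext.comp_smul]

theorem extOne_mul (y : Ext T ((shift 𝒜 j).obj T) j) (h : 0 + j = j) :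
    extMul (extOne T) y h = y := by
  have hid : (shift 𝒜 j).map (shiftZero T (Nat.cast_zero (R := ℤ))).inv ≫
      (shiftShift T (i := ((0 : ℕ) : ℤ)) (j := j) (n := j) (by omega)).hom = 𝟙 _ := rfl
  rw [extMul, extOne, Ext.mapExactFunctor_mk₀, Ext.mk₀_comp_mk₀, hid, Ext.comp_mk₀_id]

theorem extMul_one (x : Ext T ((shift 𝒜 i).obj T) i) (h : i + 0 = i) :
    extMul x (extOne T) h = x := by
  have hid : (shiftShift T (i := i) (j := ((0 : ℕ) : ℤ)) (n := i) (by omega)).hom =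
    (shiftZero ((shift 𝒜 i).obj T) (Nat.cast_zero (R := ℤ))).hom := rfl
  rw [extMul, extOne, hid, map_shift_zero, Ext.mk₀_comp_mk₀_assoc, Iso.inv_hom_id,
    Ext.mk₀_id_comp]

theorem extMul_assoc {a b c ab bc n : ℕ} (x : Ext T ((shift 𝒜 a).obj T) a)
    (y : Ext T ((shift 𝒜 b).obj T) b) (z : Ext T ((shift 𝒜 c).obj T) c)
    (hab : a + b = ab) (hbc : b + c = bc) (h₁ : ab + c = n) (h₂ : a + bc = n) :
    extMul (extMul x y hab) z h₁ = extMul x (extMul y z hbc) h₂ := by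
  have hid : (shift 𝒜 c).map (shiftShift T (i := a) (j := b) (n := ab) (by omega)).hom ≫
        (shiftShift T (i := ab) (j := c) (n := n) (by omega)).hom =
      (shiftShift ((shift 𝒜 a).obj T) (i := b) (j := c) (n := bc) (by omega)).hom ≫
        (shiftShift T (i := a) (j := bc) (n := n) (by omega)).hom := rfl
  have hx := map_shift_shift x (i := b) (j := c) (n := bc) (by omega)
  simp only [extMul, Ext.mapExactFunctor_comp, Ext.mapExactFunctor_mk₀]
  generalize (x.mapExactFunctor (shift 𝒜 b)).mapExactFunctor (shift 𝒜 c) = x₁ at hx ⊢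
  generalize x.mapExactFunctor (shift 𝒜 bc) = x₂ at hx ⊢
  generalize y.mapExactFunctor (shift 𝒜 c) = y₁
  rw [Ext.comp_assoc_of_third_deg_zero y₁, Ext.comp_assoc_of_third_deg_zero x₁,
    Ext.mk₀_comp_mk₀, hid, ← Ext.mk₀_comp_mk₀, ← Ext.comp_assoc_of_third_deg_zero x₁, hx,
    Ext.comp_assoc_of_third_deg_zero, ← Ext.comp_assoc_of_second_deg_zero y₁]
  exact (Ext.comp_assoc z _ _ _ _ (by omega)).symm

end

/-- The graded pieces `Ext^i_{Gr Λ}(T, T⟨i⟩)`, `i ≥ 0`, of the graded extension algebra of `T`. -/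
def GrExt (T : GrMod 𝒜) (i : ℕ) : Type u := Ext.{u} T ((shift 𝒜 i).obj T) i

namespace GrExt

variable (T : GrMod 𝒜)

noncomputable instance (i : ℕ) : AddCommGroup (GrExt T i) :=
  inferInstanceAs (AddCommGroup (Ext T ((shift 𝒜 i).obj T) i))

noncomputable instance (i : ℕ) : Module k (GrExt T i) :=
  inferInstanceAs (Module k (Ext T ((shift 𝒜 i).obj T) i))

noncomputable instance : GradedMonoid.GOne (GrExt T) := ⟨extOne T⟩

noncomputable instance : GradedMonoid.GMul (GrExt T) := ⟨fun x y => extMul x y rfl⟩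

variable {T}

theorem mk_mul {i j n : ℕ} (x : GrExt T i) (y : GrExt T j) (h : i + j = n) :
    GradedMonoid.mk (A := GrExt T) (i + j) (extMul x y rfl) =
      GradedMonoid.mk (A := GrExt T) n (extMul x y h) := by
  subst h
  rfl

noncomputable instance : DirectSum.GSemiring (GrExt T) where
  mul_zero x := extMul_zero x _
  zero_mul y := zero_extMul y _
  mul_add x y z := extMul_add x y z _
  add_mul x y z := add_extMul x y z _
  one_mul a := (mk_mul (extOne T) a.2 (zero_add _)).trans
    (congrArg (GradedMonoid.mk (A := GrExt T) a.1) (extOne_mul _ _))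
  mul_one a := (mk_mul a.2 (extOne T) (add_zero _)).trans
    (congrArg (GradedMonoid.mk (A := GrExt T) a.1) (extMul_one _ _))
  mul_assoc a b c := (mk_mul (extMul a.2 b.2 rfl) c.2 rfl).trans <| by
    refine Eq.trans ?_ (mk_mul a.2 (extMul b.2 c.2 rfl) (add_assoc _ _ _).symm).symm
    exact congrArg (GradedMonoid.mk (A := GrExt T) (a.1 + b.1 + c.1))
      (extMul_assoc _ _ _ _ _ _ _)
  natCast n := (n • extOne T : Ext T ((shift 𝒜 (0 : ℕ)).obj T) 0)
  natCast_zero := zero_nsmul _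
  natCast_succ n := succ_nsmul _ n

variable (T) in
/-- The structure map `k → Ext^0(T, T⟨0⟩)`, sending `c` to `c` times the identity. -/
noncomputable def scalar : k →+ GrExt T 0 where
  toFun c := (c • extOne T : Ext T ((shift 𝒜 (0 : ℕ)).obj T) 0)
  map_zero' := zero_smul _ _
  map_add' a b := add_smul a b _

noncomputable instance : DirectSum.GAlgebra k (GrExt T) where
  toFun := scalar T
  map_one := by
    change (1 : k) • extOne T = extOne T
    exact one_smul k (extOne T)
  map_mul a b := by
    refine Eq.trans ?_ (mk_mul (a • extOne T) (b • extOne T) (add_zero 0)).symm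
    refine congrArg (GradedMonoid.mk (A := GrExt T) 0) ?_
    refine Eq.trans ?_ (smul_extMul a _ _ _).symm
    exact (mul_smul a b (extOne T)).trans (congrArg (a • ·) (extOne_mul _ _).symm)
  commutes c x := by
    refine (mk_mul (c • extOne T) x.2 (zero_add _)).trans
      (Eq.trans ?_ (mk_mul x.2 (c • extOne T) (add_zero _)).symm)
    refine congrArg (GradedMonoid.mk (A := GrExt T) x.1) ?_
    refine (smul_extMul c _ _ _).trans (Eq.trans ?_ (extMul_smul c _ _ _).symm)
    exact congrArg (c • ·) ((extOne_mul _ _).trans (extMul_one _ _).symm)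
  smul_def c x := by
    refine Eq.trans ?_ (mk_mul (c • extOne T) x.2 (zero_add _)).symm
    refine congrArg (GradedMonoid.mk (A := GrExt T) x.1) ?_
    exact ((smul_extMul c _ _ _).trans (congrArg (c • ·) (extOne_mul _ _))).symm

end GrExt

attribute [local instance] Abelian.hasFiniteBiproducts

/-- A graded module is basic if it is a finite direct sum of pairwise non-isomorphic
indecomposable graded modules. -/
def IsBasic (T : GrMod 𝒜) : Prop :=
  ∃ (r : ℕ) (X : Fin r → GrMod 𝒜), (∀ h, Indecomposable (X h)) ∧
    (∀ h h', h ≠ h' → IsEmpty (X h ≅ X h')) ∧ Nonempty (T ≅ Limits.biproduct X)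

/-- Graded self-orthogonal modules: finitely generated basic graded modules `T` concentrated in
degree `0` such that `Ext^i_{Gr Λ}(T, T⟨j⟩) = 0` whenever `i ≠ j`. -/
structure IsGradedSelfOrthogonal (T : GrMod 𝒜) : Prop where
  finite : Module.Finite Λ T.carrier
  basic : T.IsBasic
  deg_zero : T.deg 0 = ⊤
  ext_eq_zero : ∀ (i : ℕ) (j : ℤ), (i : ℤ) ≠ j →
    ∀ x : Ext.{u} T ((shift 𝒜 j).obj T) i, x = 0

end GrMod

/-- The homogeneous part of degree `i` of the opposite algebra of `⨁ i, A i`. -/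
def opPart (k : Type*) [Field k] (A : ℕ → Type*) [∀ i, AddCommGroup (A i)]
    [∀ i, Module k (A i)] (i : ℕ) : Submodule k (⨁ i, A i)ᵐᵒᵖ :=
  (LinearMap.range (DirectSum.lof k ℕ A i)).map (MulOpposite.opLinearEquiv k).toLinearMap

end ExtAlgebra

/-! Since `T` lives in degree `0`, elements of `Λ` of positive degree kill it. Hence `R = ⨁_j T⟨j⟩`
is a cofree graded module on the ungraded module `T`: restricting a linear map `M → T` to the pieces
`M_j` gives `Hom_Λ(M, T) ≅ Hom_{Gr Λ}(M, R)`. The forgetful functor is exact and preserves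
projectives, so dimension shifting extends this to `Ext^n_Λ(M, T) ≅ Ext^n_{Gr Λ}(M, R)`
(`mapExactFunctor_comp_bijective`).

An infinite direct sum in the second variable of `Ext` need not split off termwise. Here, however,
the summands sit in distinct degrees, so `R` is also the product of the `T⟨j⟩` in `Gr Λ`, and a
class with values in `R` is determined by its components (`ext_eq_zero_of_components`). For `M = T`
self-orthogonality kills every component except `j = n`, which leaves `Ext^n_{Gr Λ}(T, T⟨n⟩)`
(`forgetExt_bijective`).

The resulting bijection is just forgetting the grading. Forgetting a shift does not change the
underlying module or map, so the bijection respects Yoneda products (`map_shift_forget`,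
`forgetExt_mul`). -/

/-! ### Dimension shifting in abelian categories with enough projectives. -/

section ExtComparison

open Abelian Limits

variable {C : Type*} [Category* C] [Abelian C] [EnoughProjectives C]

/-- Every object of a category with enough projectives is a quotient of a projective object. -/
theorem exists_projective_shortExact (X : C) :
    ∃ (S : ShortComplex C) (_ : S.ShortExact), S.X₃ = X ∧ Projective S.X₂ :=
  ⟨ShortComplex.mk _ _ (kernel.condition (Projective.π X)),
    { exact := ShortComplex.exact_of_f_is_kernel _ (kernelIsKernel _) }, rfl,
    inferInstanceAs (Projective (Projective.over X))⟩

/-- An extension class with values in a product is determined by its components. -/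
theorem ext_eq_zero_of_components [HasExt.{u} C] {ι : Type*} {R : C} {X : ι → C}
    (p : ∀ j, R ⟶ X j)
    (hinj : ∀ {M : C} (f g : M ⟶ R), (∀ j, f ≫ p j = g ≫ p j) → f = g)
    (hsurj : ∀ {M : C} (f : ∀ j, M ⟶ X j), ∃ g : M ⟶ R, ∀ j, g ≫ p j = f j)
    {n : ℕ} {M : C} (x : Ext M R n)
    (hx : ∀ j, x.comp (Ext.mk₀ (p j)) (add_zero n) = 0) : x = 0 := by
  induction n generalizing M with
  | zero =>
    obtain ⟨f, rfl⟩ := (Ext.mk₀_bijective M R).2 x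
    rw [Ext.mk₀_eq_zero_iff]
    refine hinj _ _ fun j => ?_
    have := hx j
    rwa [Ext.mk₀_comp_mk₀, Ext.mk₀_eq_zero_iff, ← zero_comp] at this
  | succ n ih =>
    obtain ⟨S, hS, rfl, _⟩ := exists_projective_shortExact M
    obtain ⟨y, rfl⟩ := Ext.contravariant_sequence_exact₃ hS R x (Ext.eq_zero_of_projective _)
      (add_comm 1 n)
    -- The connecting map kills each component of `y`, so each component extends along `S.f` to the
    -- projective middle term.
    have hy : ∀ j, ∃ z : Ext S.X₂ (X j) n,
        (Ext.mk₀ S.f).comp z (zero_add n) = y.comp (Ext.mk₀ (p j)) (add_zero n) := by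
      intro j
      refine Ext.contravariant_sequence_exact₁ hS (X j) _ (add_comm 1 n) ?_
      rw [← Ext.comp_assoc_of_third_deg_zero]
      exact hx j
    choose z hz using hy
    -- Assembling infinitely many classes is possible over a projective: in degree `0` this is the
    -- product property, in higher degrees everything vanishes.
    obtain ⟨w, hw⟩ : ∃ w : Ext S.X₂ R n, ∀ j, w.comp (Ext.mk₀ (p j)) (add_zero n) = z j := by
      cases n with
      | zero =>
        choose f hf using fun j => (Ext.mk₀_bijective S.X₂ (X j)).2 (z j)
        obtain ⟨g, hg⟩ := hsurj f
        exact ⟨Ext.mk₀ g, fun j => by rw [Ext.mk₀_comp_mk₀, hg, hf]⟩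
      | succ n => exact ⟨0, fun j => by rw [Ext.eq_zero_of_projective (z j), Ext.zero_comp]⟩
    have : y = (Ext.mk₀ S.f).comp w (zero_add n) := by
      rw [← sub_eq_zero]
      refine ih _ fun j => ?_
      rw [sub_eq_add_neg, Ext.add_comp, Ext.neg_comp, ← hz j, Ext.comp_assoc_of_third_deg_zero, hw,
        add_neg_cancel]
    rw [this, ShortComplex.ShortExact.extClass_comp_assoc]

variable {D : Type*} [Category* D] [Abelian D] [HasExt.{u} C] [HasExt.{u} D] (F : C ⥤ D)
  [F.Additive] [PreservesFiniteLimits F] [PreservesFiniteColimits F]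

/-- If `F` is exact and preserves projectives, and `ε : F(R) ⟶ N` is a universal arrow from `F`
to `N`, then `Ext^n(M, R) ≅ Ext^n(F(M), N)`. -/
theorem mapExactFunctor_comp_bijective (hF : ∀ P : C, Projective P → Projective (F.obj P))
    {R : C} {N : D} (ε : F.obj R ⟶ N)
    (hε : ∀ M : C, Function.Bijective fun f : M ⟶ R => F.map f ≫ ε) (n : ℕ) (M : C) :
    Function.Bijective fun x : Ext M R n =>
      (x.mapExactFunctor F).comp (Ext.mk₀ ε) (add_zero n) := by
  have hzero : ∀ M : C, Function.Bijective fun x : Ext M R 0 =>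
      (x.mapExactFunctor F).comp (Ext.mk₀ ε) (add_zero 0) := by
    intro M
    rw [← Function.Bijective.of_comp_iff _ (Ext.mk₀_bijective M R)]
    convert (Ext.mk₀_bijective (F.obj M) N).comp (hε M) using 1
    funext f
    simp only [Function.comp_apply, Ext.mapExactFunctor_mk₀, Ext.mk₀_comp_mk₀]
  have hproj : ∀ (n : ℕ) (P : C), Projective P → Function.Surjective fun x : Ext P R n =>
      (x.mapExactFunctor F).comp (Ext.mk₀ ε) (add_zero n) := by
    rintro (_ | n) P hP
    · exact (hzero P).2
    · have := hF P hP
      exact fun y => ⟨0, (Ext.eq_zero_of_projective _).trans (Ext.eq_zero_of_projective y).symm⟩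
  induction n generalizing M with
  | zero => exact hzero M
  | succ n ih =>
    obtain ⟨S, hS, rfl, hP⟩ := exists_projective_shortExact M
    have hFP := hF _ hP
    have : Projective (S.map F).X₂ := hFP
    -- Compatibility of the comparison maps with connecting maps. As both middle terms are
    -- projective, every class of degree `n + 1` comes from degree `n`.
    have hcomp : ∀ x : Ext S.X₁ R n,
        ((hS.extClass.comp x (add_comm 1 n)).mapExactFunctor F).comp (Ext.mk₀ ε) (add_zero _) =
        (hS.map_of_exact F).extClass.comp
          ((x.mapExactFunctor F).comp (Ext.mk₀ ε) (add_zero n)) (add_comm 1 n) := by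
      intro x
      rw [Ext.mapExactFunctor_comp, Ext.mapExactFunctor_extClass]
      exact Ext.comp_assoc_of_third_deg_zero _ _ _ _
    constructor
    · intro a b hab
      rw [← sub_eq_zero]
      obtain ⟨y, hy⟩ := Ext.contravariant_sequence_exact₃ hS R (a - b)
        (Ext.eq_zero_of_projective _) (add_comm 1 n)
      have h0 : ((a - b).mapExactFunctor F).comp (Ext.mk₀ ε) (add_zero _) = 0 := by
        rw [← Functor.mapExtAddHom_apply, map_sub, sub_eq_add_neg, Ext.add_comp, Ext.neg_comp,
          ← sub_eq_add_neg, sub_eq_zero]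
        exact hab
      rw [← hy, hcomp] at h0
      -- The diagram chase of the four lemma: the image of `y` extends to `F(P)`, the extension
      -- lifts to `P`, and injectivity in degree `n` shows that `y` itself extends, so its
      -- connecting class is zero.
      obtain ⟨z, hz⟩ := Ext.contravariant_sequence_exact₁ (hS.map_of_exact F) N _ _ h0
      obtain ⟨w, rfl⟩ := hproj n _ hP z
      have : y = (Ext.mk₀ S.f).comp w (zero_add n) := by
        refine (ih _).1 (hz.symm.trans ?_)
        dsimp only
        rw [Ext.mapExactFunctor_comp, Ext.mapExactFunctor_mk₀]
        exact (Ext.comp_assoc_of_third_deg_zero _ _ _ _).symm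
      rw [← hy, this, ShortComplex.ShortExact.extClass_comp_assoc]
    · intro y
      obtain ⟨z, hz⟩ := Ext.contravariant_sequence_exact₃ (hS.map_of_exact F) N y
        (Ext.eq_zero_of_projective _) (add_comm 1 n)
      obtain ⟨x, rfl⟩ := (ih _).2 z
      exact ⟨hS.extClass.comp x (add_comm 1 n), (hcomp x).trans hz⟩

end ExtComparison

/-! ### The forgetful functor: exactness, projectives, shifts. -/

namespace GrMod

open Abelian Limits

variable {k : Type v} [Field k] {Λ : Type u} [Ring Λ] [Algebra k Λ]
  {𝒜 : ℕ → Submodule k Λ} [GradedAlgebra 𝒜]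

instance : (forget 𝒜).Additive where
  map_add := rfl

instance : (forget 𝒜).Linear k where
  map_smul _ _ := rfl

theorem forget_map_shortExact {S : ShortComplex (GrMod 𝒜)} (hS : S.ShortExact) :
    (S.map (forget 𝒜)).ShortExact := by
  have := hS.mono_f
  have := hS.epi_g
  refine ModuleCat.shortComplex_shortExact _ (fun n => ⟨fun hn => ?_, ?_⟩)
    (injective_of_mono S.f) (surjective_of_epi S.g)
  · have h := hS.exact.lift_f (kerι S.g) (kerι_comp S.g)
    exact ⟨_, congr_lin h ⟨n, hn⟩⟩
  · rintro ⟨m, rfl⟩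
    exact congr_lin S.zero m

theorem forget_exact : PreservesFiniteLimits (forget 𝒜) ∧ PreservesFiniteColimits (forget 𝒜) :=
  ((forget 𝒜).exact_tfae.out 0 3 :).1 fun _ hS => forget_map_shortExact hS

instance : PreservesFiniteLimits (forget 𝒜) := forget_exact.1

instance : PreservesFiniteColimits (forget 𝒜) := forget_exact.2

/-- Records that the projective cover used for enough projectives can be taken graded free, since
freeness is what survives forgetting the grading. -/
theorem exists_free_epi (M : GrMod 𝒜) :
    ∃ (S : Type u) (d : S → ℤ) (f : free 𝒜 d ⟶ M), Epi f :=
  ⟨Σ i : ℤ, M.deg i, fun x => x.1, freeDesc _ M (fun x => x.2) fun x => x.2.2,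
    epi_of_surjective _ fun m => by
      obtain ⟨s, hs⟩ := M.exists_eq_sum_proj m
      refine ⟨∑ i ∈ s, Finsupp.single ⟨i, ⟨M.proj i m, M.proj_mem i m⟩⟩ (1 : Λ), ?_⟩
      conv_rhs => rw [hs]
      refine (map_sum (Hom.lin _) _ _).trans (Finset.sum_congr rfl fun i _ => ?_)
      rw [freeDesc_single]⟩

/-- A graded projective is a retract of a graded free module. Functors preserve retracts, and the
module underlying a graded free one is free. -/
theorem projective_forget (P : GrMod 𝒜) (hP : Projective P) :
    Projective ((forget 𝒜).obj P) := by
  obtain ⟨S, d, f, _⟩ := exists_free_epi P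
  have : Projective ((forget 𝒜).obj (free 𝒜 d)) :=
    (IsProjective.iff_projective (R := Λ) (S →₀ Λ)).1
      (Module.Projective.of_free (R := Λ) (P := S →₀ Λ))
  exact Retract.projective (Y := (forget 𝒜).obj (free 𝒜 d))
    ((⟨Projective.factorThru (𝟙 P) f, f, Projective.factorThru_comp _ _⟩ :
      Retract P (free 𝒜 d)).map (forget 𝒜))

/-- The identity, as an isomorphism between the ungraded modules underlying `M⟨j⟩` and `M`. -/
def forgetShift (M : GrMod 𝒜) (j : ℤ) :
    (forget 𝒜).obj ((shift 𝒜 j).obj M) ≅ (forget 𝒜).obj M :=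
  Iso.refl (ModuleCat.of Λ M.carrier)

/-- Forgetting the grading of a shifted extension class. -/
theorem map_shift_forget {X Y : GrMod 𝒜} {a : ℕ} (x : Ext X Y a) (j : ℤ) :
    ((x.mapExactFunctor (shift 𝒜 j)).mapExactFunctor (forget 𝒜)).comp
        (Ext.mk₀ (forgetShift Y j).hom) (add_zero a) =
      (Ext.mk₀ (forgetShift X j).hom).comp (x.mapExactFunctor (forget 𝒜)) (zero_add a) := by
  induction a generalizing X with
  | zero =>
    obtain ⟨f, rfl⟩ := (Ext.mk₀_bijective X Y).2 x
    simp only [Ext.mapExactFunctor_mk₀, Ext.mk₀_comp_mk₀]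
    rfl
  | succ a ih =>
    obtain ⟨S, hS, rfl, y, rfl⟩ := exists_extClass_comp x
    -- The identities on the three underlying modules form a morphism of short exact sequences, so
    -- naturality of the extension class applies.
    have hcls : ((hS.extClass.mapExactFunctor (shift 𝒜 j)).mapExactFunctor (forget 𝒜)).comp
          (Ext.mk₀ (forgetShift S.X₁ j).hom) (add_zero 1) =
        (Ext.mk₀ (forgetShift S.X₃ j).hom).comp
          (hS.extClass.mapExactFunctor (forget 𝒜)) (zero_add 1) := by
      rw [Ext.mapExactFunctor_extClass, Ext.mapExactFunctor_extClass]
      refine Eq.trans (congrArg (fun z => Ext.comp z _ _)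
        (Ext.mapExactFunctor_extClass (forget 𝒜) (hS.map_of_exact (shift 𝒜 j)))) ?_
      exact (ShortComplex.ShortExact.extClass_naturality
        ((hS.map_of_exact (shift 𝒜 j)).map_of_exact (forget 𝒜)) (hS.map_of_exact (forget 𝒜))
        { τ₁ := (forgetShift S.X₁ j).hom
          τ₂ := (forgetShift S.X₂ j).hom
          τ₃ := (forgetShift S.X₃ j).hom
          comm₁₂ := rfl
          comm₂₃ := rfl })
    simp only [Ext.mapExactFunctor_comp]
    rw [Ext.comp_assoc_of_third_deg_zero, ih, ← Ext.comp_assoc_of_second_deg_zero, hcls,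
      Ext.comp_assoc _ _ _ (zero_add 1) (add_comm 1 a) (by omega)]

end GrMod

/-! ### The cofree graded module on a module concentrated in degree zero. -/

namespace GrMod

open Abelian Limits

variable {k : Type v} [Field k] {Λ : Type u} [Ring Λ] [Algebra k Λ]
  {𝒜 : ℕ → Submodule k Λ} [GradedAlgebra 𝒜]

theorem hom_ext_homogeneous {M N : GrMod 𝒜} {f g : M ⟶ N}
    (h : ∀ (i : ℤ), ∀ m ∈ M.deg i, Hom.lin f m = Hom.lin g m) : f = g :=
  hom_ext fun m => by
    obtain ⟨s, hs⟩ := M.exists_eq_sum_proj m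
    rw [hs, map_sum, map_sum]
    exact Finset.sum_congr rfl fun i _ => h i _ (M.proj_mem i m)

section DegreeZero

variable {T : GrMod 𝒜} (hT : T.deg 0 = ⊤)

include hT

theorem eq_zero_of_mem_deg {i : ℤ} (hi : i ≠ 0) {t : T.carrier} (ht : t ∈ T.deg i) : t = 0 := by
  rw [← T.proj_same ht]
  exact T.proj_ne (hT ▸ AddSubgroup.mem_top t) hi.symm

/-- The product lies in `T_i = 0`. In a cofree module `a` would carry the copy of `T` in degree `j`
to the one in degree `i + j`; this vanishing is why the copies split into a direct sum of shifts. -/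
theorem smul_eq_zero_of_pos {i : ℕ} (hi : i ≠ 0) {a : Λ} (ha : a ∈ 𝒜 i) (t : T.carrier) :
    a • t = 0 := by
  refine eq_zero_of_mem_deg hT (i := i) (by exact_mod_cast hi) ?_
  have := T.smul_mem (j := 0) ha (hT ▸ AddSubgroup.mem_top t)
  rwa [add_zero] at this

/-- If `T` is concentrated in degree `0`, the homogeneous components of a linear map to `T` are
linear. -/
theorem map_proj_smul {M : GrMod 𝒜} (f : M.carrier →ₗ[Λ] T.carrier) (j : ℤ) (a : Λ)
    (m : M.carrier) : f (M.proj j (a • m)) = a • f (M.proj j m) := by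
  induction a using DirectSum.Decomposition.inductionOn 𝒜 with
  | zero => simp
  | add a b ha hb => rw [add_smul, map_add, map_add, ha, hb, add_smul]
  | @homogeneous i a =>
    obtain ⟨s, hs⟩ := M.exists_eq_sum_proj m
    have key : ∀ l, f (M.proj j ((a : Λ) • M.proj l m)) = (a : Λ) • f (M.proj j (M.proj l m)) := by
      intro l
      have hl := M.smul_mem a.2 (M.proj_mem l m)
      -- Scalars of degree `0` commute with the projections. Scalars of positive degree act as zero
      -- on `T`, so both sides vanish, whatever component the projection selects.
      by_cases hi : i = 0
      · subst hi
        rw [Nat.cast_zero, zero_add] at hl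
        by_cases h : l = j
        · subst h
          rw [M.proj_same hl, M.proj_same (M.proj_mem _ _), map_smul]
        · rw [M.proj_ne hl h, M.proj_ne (M.proj_mem _ _) h, map_zero, smul_zero]
      · rw [smul_eq_zero_of_pos hT hi a.2]
        by_cases h : i + l = j
        · rw [M.proj_same (h ▸ hl), map_smul, smul_eq_zero_of_pos hT hi a.2]
        · rw [M.proj_ne hl h, map_zero]
    rw [hs]
    simp only [Finset.smul_sum, map_sum, key]

/-- The direct sum of all the shifts `T⟨j⟩` of a graded module `T` concentrated in degree `0`. -/
noncomputable def sumShift : GrMod 𝒜 where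
  carrier := ℤ →₀ T.carrier
  deg j := (Finsupp.singleAddHom j).range
  isInternal := by
    refine isInternal_of_proj
      (fun i => (Finsupp.singleAddHom i).comp (Finsupp.applyAddHom i)) ?_ ?_ ?_
    · rintro i _ ⟨t, rfl⟩
      simp
    · rintro i j h _ ⟨t, rfl⟩
      simp [Finsupp.single_eq_of_ne h.symm]
    · intro x
      induction x using Finsupp.induction_linear with
      | zero => exact zero_mem _
      | add x y hx hy => exact add_mem hx hy
      | single j t => exact AddSubgroup.mem_iSup_of_mem j ⟨t, rfl⟩
  -- The componentwise action keeps the index `j` where the grading asks for `i + j`. The two agree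
  -- for `i = 0`, and otherwise the product is zero.
  smul_mem := by
    rintro i j a _ ha ⟨t, rfl⟩
    by_cases hi : i = 0
    · subst hi
      rw [Nat.cast_zero, zero_add]
      exact ⟨a • t, (Finsupp.smul_single a j t).symm⟩
    · rw [Finsupp.singleAddHom_apply, Finsupp.smul_single, smul_eq_zero_of_pos hT hi ha,
        Finsupp.single_zero]
      exact zero_mem _

/-- The projection from the direct sum of the shifts of `T` to `T⟨j⟩`. -/
noncomputable def sumShiftπ (j : ℤ) : sumShift hT ⟶ (shift 𝒜 j).obj T :=
  ofLin (M := sumShift hT) (N := shiftObj j T) (Finsupp.lapply j) (by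
    rintro i _ ⟨t, rfl⟩
    change Finsupp.single i t j ∈ T.deg (i - j)
    by_cases h : i = j
    · rw [h, sub_self, hT]
      trivial
    · rw [Finsupp.single_eq_of_ne' h]
      exact zero_mem _)

/-- The inclusion of `T⟨j⟩` into the direct sum of the shifts of `T`. -/
noncomputable def sumShiftι (j : ℤ) : (shift 𝒜 j).obj T ⟶ sumShift hT :=
  ofLin (M := shiftObj j T) (N := sumShift hT) (Finsupp.lsingle j) (by
    intro i t ht
    by_cases h : i = j
    · subst h
      exact ⟨t, rfl⟩
    · rw [eq_zero_of_mem_deg hT (sub_ne_zero.2 h) ht]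
      exact ⟨0, (Finsupp.single_zero i).trans (Finsupp.single_zero j).symm⟩)

/-- The linear map from the direct sum of the shifts of `T` to `T` which sums the components. -/
noncomputable def sumShiftSum : (sumShift hT).carrier →ₗ[Λ] T.carrier :=
  Finsupp.lsum (M := T.carrier) ℕ fun _ : ℤ => LinearMap.id

/-- The morphism to the direct sum of the shifts of `T` whose components are the homogeneous
components of the given linear maps. -/
noncomputable def sumShiftLift {M : GrMod 𝒜} (f : ℤ → M.carrier →ₗ[Λ] T.carrier) :
    M ⟶ sumShift hT :=
  ofLin (M := M) (N := sumShift hT)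
    { toFun := fun m => Finsupp.ofSupportFinite (fun j => f j (M.proj j m)) (by
        -- Only finitely many projections of `m` are nonzero, so even an infinite family of maps
        -- lands in the direct sum.
        obtain ⟨s, hs⟩ := M.exists_eq_sum_proj m
        refine s.finite_toSet.subset fun j hj => ?_
        by_contra h
        refine hj ?_
        dsimp only
        rw [hs, map_sum, Finset.sum_eq_zero, map_zero]
        exact fun i hi => M.proj_ne (M.proj_mem _ _) fun e => h (e ▸ hi))
      map_add' := fun m n => Finsupp.ext fun j => by
        change f j (M.proj j (m + n)) = f j (M.proj j m) + f j (M.proj j n)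
        rw [map_add, map_add]
      map_smul' := fun a m => Finsupp.ext fun j => map_proj_smul hT (f j) j a m }
    fun {i m} hm => ⟨f i m, Finsupp.ext fun j => by
      change Finsupp.single i (f i m) j = f j (M.proj j m)
      by_cases h : i = j
      · subst h
        rw [Finsupp.single_eq_same, M.proj_same hm]
      · rw [Finsupp.single_eq_of_ne' h, M.proj_ne hm h, map_zero]⟩

theorem sumShiftLift_of_mem {M : GrMod 𝒜} (f : ℤ → M.carrier →ₗ[Λ] T.carrier) {i : ℤ}
    {m : M.carrier} (hm : m ∈ M.deg i) :
    Hom.lin (sumShiftLift hT f) m = Finsupp.single i (f i m) := by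
  refine Finsupp.ext fun j => ?_
  change f j (M.proj j m) = Finsupp.single i (f i m) j
  by_cases h : i = j
  · subst h
    rw [Finsupp.single_eq_same, M.proj_same hm]
  · rw [Finsupp.single_eq_of_ne' h, M.proj_ne hm h, map_zero]

theorem sumShiftSum_single (i : ℤ) (t : T.carrier) :
    sumShiftSum hT (Finsupp.single i t : ℤ →₀ T.carrier) = t :=
  (Finsupp.lsum_single ℕ _ i t).trans rfl

theorem sumShiftSum_lift {M : GrMod 𝒜} (f : M.carrier →ₗ[Λ] T.carrier) (m : M.carrier) :
    sumShiftSum hT (Hom.lin (sumShiftLift hT fun _ => f) m) = f m := by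
  obtain ⟨s, hs⟩ := M.exists_eq_sum_proj m
  rw [hs, map_sum, map_sum, map_sum]
  refine Finset.sum_congr rfl fun i _ => ?_
  rw [sumShiftLift_of_mem hT _ (M.proj_mem i m)]
  exact sumShiftSum_single hT i _

/-- The universal arrow from the forgetful functor to the module underlying `T`. -/
noncomputable def sumShiftε : (forget 𝒜).obj (sumShift hT) ⟶ (forget 𝒜).obj T :=
  ModuleCat.ofHom (sumShiftSum hT)

/-- With `exists_comp_sumShiftπ` this says that the direct sum of the shifts is also their product
in `Gr Λ`. -/
theorem sumShift_hom_ext {M : GrMod 𝒜} (f g : M ⟶ sumShift hT)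
    (h : ∀ j, f ≫ sumShiftπ hT j = g ≫ sumShiftπ hT j) : f = g :=
  hom_ext fun m => Finsupp.ext fun j => congr_lin (h j) m

theorem exists_comp_sumShiftπ {M : GrMod 𝒜} (f : ∀ j, M ⟶ (shift 𝒜 j).obj T) :
    ∃ g : M ⟶ sumShift hT, ∀ j, g ≫ sumShiftπ hT j = f j := by
  refine ⟨sumShiftLift hT fun j => Hom.lin (N := shiftObj j T) (f j), fun j => hom_ext fun m => ?_⟩
  change Hom.lin (f j) (M.proj j m) = Hom.lin (f j) m
  rw [lin_proj]
  -- All of `T⟨j⟩` has degree `j`, so replacing `m` by its component of degree `j` does not change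
  -- the value.
  refine GrMod.proj_same _ ?_
  change _ ∈ T.deg (j - j)
  rw [sub_self, hT]
  trivial

/-- A graded map sends degree `i` into the `i`-th copy of `T`, on which summation is injective; this
gives uniqueness. For existence, a linear map is the sum of its homogeneous components, each of
which is linear by `map_proj_smul`. -/
theorem map_comp_sumShiftε_bijective (M : GrMod 𝒜) :
    Function.Bijective fun f : M ⟶ sumShift hT => (forget 𝒜).map f ≫ sumShiftε hT := by
  constructor
  · intro f g hfg
    refine hom_ext_homogeneous fun i m hm => ?_
    obtain ⟨s, hs⟩ := lin_mem f hm
    obtain ⟨t, ht⟩ := lin_mem g hm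
    have h : sumShiftSum hT (Hom.lin f m) = sumShiftSum hT (Hom.lin g m) :=
      ConcreteCategory.congr_hom hfg m
    rw [← hs, ← ht] at h ⊢
    rw [(sumShiftSum_single hT i s).symm.trans (h.trans (sumShiftSum_single hT i t))]
  · intro h
    exact ⟨sumShiftLift hT fun _ => h.hom,
      ModuleCat.hom_ext (LinearMap.ext fun m => sumShiftSum_lift hT h.hom m)⟩

theorem map_sumShiftι_comp_ε (j : ℤ) :
    (forget 𝒜).map (sumShiftι hT j) ≫ sumShiftε hT = (forgetShift T j).hom :=
  ModuleCat.hom_ext (LinearMap.ext fun t => sumShiftSum_single hT j t)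

theorem sumShiftι_comp_π_same (j : ℤ) : sumShiftι hT j ≫ sumShiftπ hT j = 𝟙 _ :=
  hom_ext fun _ => Finsupp.single_eq_same

/-! ### Comparison of graded and ungraded extension groups. -/

/-- By `map_sumShiftι_comp_ε` the map factors as inclusion of the `i`-th summand followed by the
cofree bijection. The inclusion is split on `Ext` by the projection, and it is onto because all
other components vanish. -/
theorem forgetExt_bijective {M : GrMod 𝒜} {n : ℕ} {i : ℤ}
    (hM : ∀ j, j ≠ i → ∀ x : Ext M ((shift 𝒜 j).obj T) n, x = 0) :
    Function.Bijective fun x : Ext M ((shift 𝒜 i).obj T) n =>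
      (x.mapExactFunctor (forget 𝒜)).comp (Ext.mk₀ (forgetShift T i).hom) (add_zero n) := by
  have hψ := mapExactFunctor_comp_bijective (forget 𝒜) projective_forget (sumShiftε hT)
    (map_comp_sumShiftε_bijective hT) n M
  have hφ : ∀ x : Ext M ((shift 𝒜 i).obj T) n,
      ((x.comp (Ext.mk₀ (sumShiftι hT i)) (add_zero n)).mapExactFunctor (forget 𝒜)).comp
        (Ext.mk₀ (sumShiftε hT)) (add_zero n) =
      (x.mapExactFunctor (forget 𝒜)).comp (Ext.mk₀ (forgetShift T i).hom) (add_zero n) := by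
    intro x
    rw [Ext.mapExactFunctor_comp, Ext.mapExactFunctor_mk₀, Ext.comp_assoc_of_third_deg_zero,
      Ext.mk₀_comp_mk₀, map_sumShiftι_comp_ε]
  have hπ : ∀ x : Ext M ((shift 𝒜 i).obj T) n,
      (x.comp (Ext.mk₀ (sumShiftι hT i)) (add_zero n)).comp
        (Ext.mk₀ (sumShiftπ hT i)) (add_zero n) = x := by
    intro x
    rw [Ext.comp_assoc_of_third_deg_zero, Ext.mk₀_comp_mk₀, sumShiftι_comp_π_same,
      Ext.comp_mk₀_id]
  constructor
  · intro x y hxy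
    dsimp only at hxy
    rw [← hφ x, ← hφ y] at hxy
    rw [← hπ x, ← hπ y, hψ.1 hxy]
  · intro y
    obtain ⟨z, rfl⟩ := hψ.2 y
    refine ⟨z.comp (Ext.mk₀ (sumShiftπ hT i)) (add_zero n), ?_⟩
    dsimp only
    rw [← hφ]
    -- It remains to see that `z` equals the inclusion of its own `i`-th component; this is checked
    -- component by component.
    congr 2
    rw [← sub_eq_zero]
    refine ext_eq_zero_of_components (sumShiftπ hT) (sumShift_hom_ext hT)
      (exists_comp_sumShiftπ hT) _ fun j => ?_
    by_cases h : j = i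
    · subst h
      rw [sub_eq_add_neg, Ext.add_comp, Ext.neg_comp, hπ, add_neg_cancel]
    · exact hM j h _

end DegreeZero

end GrMod

/-! ### The isomorphism of extension algebras. -/

namespace GrMod

open Abelian

variable {k : Type v} [Field k] {Λ : Type u} [Ring Λ] [Algebra k Λ]
  {𝒜 : ℕ → Submodule k Λ} [GradedAlgebra 𝒜]

/-- The comparison map `Ext^n_{Gr Λ}(T, T⟨n⟩) → Ext^n_Λ(T, T)`. -/
noncomputable def forgetExt (T : GrMod 𝒜) (n : ℕ) :
    GrExt T n →ₗ[k] SelfExt ((forget 𝒜).obj T) n where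
  toFun (x : Ext T ((shift 𝒜 n).obj T) n) :=
    (x.mapExactFunctor (forget 𝒜)).comp (Ext.mk₀ (forgetShift T n).hom) (add_zero n)
  map_add' (x y : Ext T ((shift 𝒜 n).obj T) n) := by
    refine Eq.trans ?_ (Ext.add_comp _ _ _ _)
    rw [← Ext.mapExactFunctor_add]
    rfl
  map_smul' c (x : Ext T ((shift 𝒜 n).obj T) n) := by
    refine Eq.trans ?_ (Ext.smul_comp _ _ _ c)
    rw [← Functor.mapExactFunctor_smul]
    rfl

theorem forgetExt_one (T : GrMod 𝒜) : forgetExt T 0 (extOne T) = SelfExt.one _ := by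
  change ((extOne T).mapExactFunctor (forget 𝒜)).comp
    (Ext.mk₀ (forgetShift T (0 : ℕ)).hom) (add_zero 0) = Ext.mk₀ (𝟙 _)
  rw [extOne, Ext.mapExactFunctor_mk₀, Ext.mk₀_comp_mk₀]
  rfl

/-- After forgetting, `x⟨j⟩` becomes `x` and `T⟨i⟩⟨j⟩ ≅ T⟨i+j⟩` becomes the identity, so the twisted
product turns into the ordinary Yoneda product. -/
theorem forgetExt_mul (T : GrMod 𝒜) {i j n : ℕ} (x : GrExt T i) (y : GrExt T j)
    (h : i + j = n) :
    forgetExt T n (extMul x y h) = SelfExt.mul (forgetExt T i x) (forgetExt T j y) h := by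
  change Ext T ((shift 𝒜 i).obj T) i at x
  change Ext T ((shift 𝒜 j).obj T) j at y
  have hid : (forget 𝒜).map (shiftShift T (i := i) (j := j) (n := n) (by omega)).hom ≫
      (forgetShift T n).hom = (forgetShift ((shift 𝒜 i).obj T) j).hom ≫ (forgetShift T i).hom :=
    rfl
  change ((extMul x y h).mapExactFunctor (forget 𝒜)).comp (Ext.mk₀ (forgetShift T n).hom)
      (add_zero n) =
    ((y.mapExactFunctor (forget 𝒜)).comp (Ext.mk₀ (forgetShift T j).hom) (add_zero j)).comp
      ((x.mapExactFunctor (forget 𝒜)).comp (Ext.mk₀ (forgetShift T i).hom) (add_zero i))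
      ((add_comm j i).trans h)
  have hx := map_shift_forget x j
  rw [extMul, Ext.mapExactFunctor_comp, Ext.mapExactFunctor_comp, Ext.mapExactFunctor_mk₀]
  -- With the mapped classes treated as variables, only associativity, `hid` and the shift relation
  -- `hx` are needed.
  generalize (x.mapExactFunctor (shift 𝒜 j)).mapExactFunctor (forget 𝒜) = x₁ at hx ⊢
  generalize x.mapExactFunctor (forget 𝒜) = x₂ at hx ⊢
  generalize y.mapExactFunctor (forget 𝒜) = y₁
  rw [Ext.comp_assoc_of_third_deg_zero y₁, Ext.comp_assoc_of_third_deg_zero x₁,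
    Ext.mk₀_comp_mk₀, hid, ← Ext.mk₀_comp_mk₀, ← Ext.comp_assoc_of_third_deg_zero x₁, hx,
    Ext.comp_assoc_of_third_deg_zero, ← Ext.comp_assoc_of_second_deg_zero y₁]

/-- For a graded self-orthogonal module `T`, forgetting the grading is an isomorphism
`Ext^n_{Gr Λ}(T, T⟨n⟩) ≅ Ext^n_Λ(T, T)`. -/
noncomputable def forgetExtEquiv {T : GrMod 𝒜} (hT : T.IsGradedSelfOrthogonal) (n : ℕ) :
    GrExt T n ≃ₗ[k] SelfExt ((forget 𝒜).obj T) n :=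
  LinearEquiv.ofBijective (forgetExt T n)
    (forgetExt_bijective hT.deg_zero fun j hj => hT.ext_eq_zero n j hj.symm)

theorem congrLinearEquiv_forgetExtEquiv_of {T : GrMod 𝒜} (hT : T.IsGradedSelfOrthogonal)
    (i : ℕ) (x : GrExt T i) :
    DirectSum.congrLinearEquiv (forgetExtEquiv hT) (DirectSum.of (GrExt T) i x) =
      DirectSum.of (SelfExt ((forget 𝒜).obj T)) i (forgetExt T i x) := by
  rw [DirectSum.coe_congrLinearEquiv]
  exact DirectSum.lmap_lof (fun i => (forgetExtEquiv hT i).toLinearMap) i x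

/-- For a graded self-orthogonal module `T`, forgetting the grading is an isomorphism between
the extension algebras of `T` in `Gr Λ` and in `Mod Λ`. -/
noncomputable def forgetExtAlgEquiv {T : GrMod 𝒜} (hT : T.IsGradedSelfOrthogonal) :
    (⨁ i, GrExt T i) ≃ₐ[k] ⨁ i, SelfExt ((forget 𝒜).obj T) i :=
  AlgEquiv.ofLinearEquiv (DirectSum.congrLinearEquiv (forgetExtEquiv hT))
    (by
      rw [DirectSum.one_def, DirectSum.one_def, congrLinearEquiv_forgetExtEquiv_of]
      exact congrArg _ (forgetExt_one T))
    (by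
      intro x y
      induction x using DirectSum.induction_on with
      | zero => simp only [zero_mul, map_zero]
      | add x x' hx hx' => simp only [add_mul, map_add, hx, hx']
      | of i x =>
        induction y using DirectSum.induction_on with
        | zero => simp only [mul_zero, map_zero]
        | add y y' hy hy' => simp only [mul_add, map_add, hy, hy']
        | of j y =>
          simp only [DirectSum.of_mul_of, congrLinearEquiv_forgetExtEquiv_of]
          exact congrArg _ (forgetExt_mul T x y rfl))

theorem forgetExtAlgEquiv_lof {T : GrMod 𝒜} (hT : T.IsGradedSelfOrthogonal) (i : ℕ)
    (x : GrExt T i) :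
    forgetExtAlgEquiv hT (DirectSum.lof k ℕ (GrExt T) i x) =
      DirectSum.lof k ℕ (SelfExt ((forget 𝒜).obj T)) i (forgetExtEquiv hT i x) :=
  congrLinearEquiv_forgetExtEquiv_of hT i x

end GrMod

theorem corollary3p3 {k : Type v} [Field k] {Λ : Type u} [Ring Λ] [Algebra k Λ]
    (𝒜 : ℕ → Submodule k Λ) [GradedAlgebra 𝒜] (T : GrMod 𝒜)
    (hT : T.IsGradedSelfOrthogonal) :
    ∃ Φ : (⨁ i, SelfExt ((GrMod.forget 𝒜).obj T) i)ᵐᵒᵖ ≃ₐ[k] (⨁ i, GrMod.GrExt T i)ᵐᵒᵖ,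
      ∀ i, (opPart k (SelfExt ((GrMod.forget 𝒜).obj T)) i).map Φ.toLinearMap =
        opPart k (GrMod.GrExt T) i := by
  -- Forgetting goes from the graded side to the ungraded one, hence the inverse. It is bijective in
  -- each degree separately, so homogeneous parts correspond exactly.
  refine ⟨AlgEquiv.op (GrMod.forgetExtAlgEquiv hT).symm, fun i => ?_⟩
  have hsymm : ∀ x, (GrMod.forgetExtAlgEquiv hT).symm
      (DirectSum.lof k ℕ (SelfExt ((GrMod.forget 𝒜).obj T)) i x) =
        DirectSum.lof k ℕ (GrMod.GrExt T) i ((GrMod.forgetExtEquiv hT i).symm x) := by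
    intro x
    rw [AlgEquiv.symm_apply_eq, GrMod.forgetExtAlgEquiv_lof, LinearEquiv.apply_symm_apply]
  apply le_antisymm
  · rintro _ ⟨_, ⟨_, ⟨x, rfl⟩, rfl⟩, rfl⟩
    exact ⟨_, ⟨_, rfl⟩, congrArg MulOpposite.op (hsymm x).symm⟩
  · rintro _ ⟨_, ⟨x, rfl⟩, rfl⟩
    refine ⟨_, ⟨_, ⟨GrMod.forgetExtEquiv hT i x, rfl⟩, rfl⟩, congrArg MulOpposite.op ?_⟩
    exact (hsymm _).trans (congrArg _ (LinearEquiv.symm_apply_apply _ x))
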